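/- Let $\rho,\mu_1,\mu_2:\mathbb{R}\to\mathbb{R}$ be $1$-periodic, piecewise continuous (finitely many discontinuities in each bounded interval, with finite one-sided limits) and strictly positive (bounded below by a positive constant). Write $\langle f\rangle=\int_0^1 f(y)\,\mathrm{d}y$. For real $K$ and $k$ let $\mathcal{A}_K(k)$ be the operator $$\mathcal{A}_K u=-\frac1\rho(\mu_1u')'+k^2\frac{\mu_2}{\rho}u$$ acting on the functions $u:[0,1]\to\mathbb{C}$ such that $u$ and $\mu_1u'$ are absolutely continuous on $[0,1]$ and $u(1)=\mathrm{e}^{iK}u(0)$, $(\mu_1u')(1)=\mathrm{e}^{iK}(\mu_1u')(0)$ (here $\mu_1u'$ denotes its absolutely continuous representative, and the eigenvalue equation $\mathcal{A}_Ku=\omega^2u$ is understood almost everywhere on $[0,1]$). Then for all $K\in[-\pi,\pi]$ and $k\in\mathbb{R}$ the operator $\mathcal{A}_K(k)$ has a least eigenvalue $\omega_1^2(K,k)$, and $$k^2\inf_{y\in[0,1]}\frac{\mu_2(y)}{\rho(y)}\le\omega_1^2(K,k)\le\frac{\langle\mu_1\rangle}{\langle\rho\rangle}K^2+\frac{\langle\mu_2\rangle}{\langle\rho\rangle}k^2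 .$$ Moreover, with $\omega_1(K,k)\ge0$ denoting the non-negative square root of $\omega_1^2(K,k)$, for every $k\in\mathbb{R}$ $$|k|\inf_{y\in[0,1]}\sqrt{\frac{\mu_2(y)}{\rho(y)}}\le\omega_1(0,k)\le|k|\sqrt{\frac{\langle\mu_2\rangle}{\langle\rho\rangle}},\qquad \omega_1(0,k)<\omega_1(\pi,k)\le\sqrt{\frac{\langle\mu_1\rangle}{\langle\rho\rangle}\pi^2+\frac{\langle\mu_2\rangle}{\langle\rho\rangle}k^2}.$$ -/

import Mathlib

open MeasureTheory Set Filter Topology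

noncomputable section

namespace LayeredWave

/-- Piecewise continuity on the line: finitely many discontinuities in every bounded interval,
and finite one-sided limits at every point. -/
def PiecewiseContinuous (f : ℝ → ℝ) : Prop :=
  (∀ a b : ℝ, {x ∈ Icc a b | ¬ ContinuousAt f x}.Finite) ∧
    ∀ x : ℝ, (∃ l : ℝ, Tendsto f (𝓝[<] x) (𝓝 l)) ∧ ∃ l : ℝ, Tendsto f (𝓝[>] x) (𝓝 l)

/-- Admissible material coefficients: `1`-periodic, piecewise continuous and strictly positive
(that is, bounded below by a positive constant, so that the one-sided limits at the
discontinuities are positive too). -/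
structure IsCoefficient (f : ℝ → ℝ) : Prop where
  periodic : Function.Periodic f 1
  piecewiseContinuous : PiecewiseContinuous f
  strictlyPositive : ∃ c : ℝ, 0 < c ∧ ∀ y, c ≤ f y

/-- The mean value `⟨f⟩` over the unit period. -/
def mean (f : ℝ → ℝ) : ℝ := ∫ y in (0 : ℝ)..1, f y

/-- `u` belongs to the domain `D_K`, and `w` is the absolutely continuous function `μ₁ u'`:
`u ∈ AC[0,1]`, `μ₁ u' ∈ AC[0,1]`, and both `u` and `μ₁ u'` are multiplied by `exp (i K)` over the
period. As `u` is differentiable only almost everywhere, `w = μ₁ u'` is an identity almost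
everywhere; it determines the continuous function `w` on `[0,1]`. -/
structure InDomain (μ₁ : ℝ → ℝ) (K : ℝ) (u w : ℝ → ℂ) : Prop where
  ac : AbsolutelyContinuousOnInterval u 0 1
  ac_flux : AbsolutelyContinuousOnInterval w 0 1
  flux_eq : ∀ᵐ y ∂(volume.restrict (Icc (0 : ℝ) 1)), w y = (μ₁ y : ℂ) * deriv u y
  bc : u 1 = Complex.exp (Complex.I * K) * u 0
  bc_flux : w 1 = Complex.exp (Complex.I * K) * w 0

/-- The function `-(1/ρ) (μ₁ u')' + k² (μ₂/ρ) u`, where `w` stands for `μ₁ u'`. -/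
def operatorA (ρ μ₂ : ℝ → ℝ) (k : ℝ) (u w : ℝ → ℂ) (y : ℝ) : ℂ :=
  -(1 / (ρ y : ℂ)) * deriv w y + (k : ℂ) ^ 2 * ((μ₂ y : ℂ) / (ρ y : ℂ)) * u y

/-- The set of (real) eigenvalues `ω²` of the operator `A_K(k)` with domain `D_K`. The
eigenfunction `u` is continuous, so it is a nonzero element of `L²` exactly when it does not
vanish identically on `[0,1]`. -/
def eigenvalues (ρ μ₁ μ₂ : ℝ → ℝ) (K k : ℝ) : Set ℝ :=
  {lam : ℝ | ∃ u w : ℝ → ℂ, InDomain μ₁ K u w ∧ (∃ y ∈ Icc (0 : ℝ) 1, u y ≠ 0) ∧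
    ∀ᵐ y ∂(volume.restrict (Icc (0 : ℝ) 1)), operatorA ρ μ₂ k u w y = (lam : ℂ) * u y}

/-- The first eigenvalue `ω₁²(K,k)`. -/
def firstEigenvalue (ρ μ₁ μ₂ : ℝ → ℝ) (K k : ℝ) : ℝ := sInf (eigenvalues ρ μ₁ μ₂ K k)

/-- The first branch `ω₁(K,k) ≥ 0`. -/
def omegaOne (ρ μ₁ μ₂ : ℝ → ℝ) (K k : ℝ) : ℝ := √(firstEigenvalue ρ μ₁ μ₂ K k)

end LayeredWave

end

/-! The first eigenvalue is the minimum of the Rayleigh quotient `energy / mass` over quasi-periodic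
`H¹` functions on the cell, and each bound comes from a choice of trial function.

Existence. Quasi-periodic functions are parametrised linearly by `h` in `L²`, with `u(0) = ⟪1, h⟫`
and `u' = h - (2 - exp (iK)) u(0)`. Energy and mass become positive bounded operators `formA` and
`formB` on one Hilbert space. Their sum is coercive and `formB` is compact (Arzelà–Ascoli), so
`exists_rayleigh_minimizer` provides a minimizer. Its Euler–Lagrange equation, integrated by parts,
shows that `μ₁ u'` is absolutely continuous and satisfies the flux boundary condition
(`exists_eigenfunction`). Conversely, every eigenfunction satisfies `lam * mass = energy`, so the
minimum is the least eigenvalue (`firstEigenvalue_spec`).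

Bounds. The trial function `exp (iKy)` gives the upper bound. Dropping the `μ₁` term from the energy
of an eigenfunction gives the lower one.

Strict inequality. If `u` is a ground state for `K`, then `|u|` is periodic with the same mass and
no more energy, so the eigenvalue at `0` is at most that at `K`. Equality at `K = π` would make one
number both a periodic and an antiperiodic eigenvalue. The constant Wronskian and uniqueness for the
initial value problem exclude this (`eigenvalues_zero_pi_disjoint`). -/

noncomputable section

namespace LayeredWave

open scoped InnerProductSpace ENNReal ComplexConjugate symmDiff BoundedContinuousFunction

/-! ### Minimizing a Rayleigh quotient in a Hilbert space. -/

section Hilbert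

variable {E : Type*} [NormedAddCommGroup E] [InnerProductSpace ℂ E]

/-- Positivity is tested at `h - t D h` with `t = 1 / (‖D‖ + 1)`; the `+ 1` keeps `t` defined when
`D = 0`. The consequence used later is that `⟪D hₙ, hₙ⟫ → 0` forces `D hₙ → 0`. -/
theorem norm_sq_apply_le_of_isPositive {D : E →L[ℂ] E} (hD : D.IsPositive) (h : E) :
    ‖D h‖ ^ 2 ≤ (‖D‖ + 1) * (⟪D h, h⟫_ℂ).re := by
  set M : ℝ := ‖D‖ + 1 with hM
  have hM0 : 0 < M := by positivity
  set t : ℝ := M⁻¹ with ht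
  have h1 := hD.re_inner_nonneg_left (h - (t : ℂ) • D h)
  have h2 : ⟪D (D h), h⟫_ℂ = ⟪D h, D h⟫_ℂ := hD.inner_left_eq_inner_right _ _
  have h3 : (⟪D (D h), D h⟫_ℂ).re ≤ M * ‖D h‖ ^ 2 := by
    calc (⟪D (D h), D h⟫_ℂ).re ≤ ‖⟪D (D h), D h⟫_ℂ‖ := Complex.re_le_norm _
      _ ≤ ‖D (D h)‖ * ‖D h‖ := norm_inner_le_norm _ _
      _ ≤ (‖D‖ * ‖D h‖) * ‖D h‖ := by gcongr; exact D.le_opNorm _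
      _ ≤ M * ‖D h‖ ^ 2 := by
        rw [hM]; nlinarith [sq_nonneg ‖D h‖]
  have h4 : (⟪D h, D h⟫_ℂ).re = ‖D h‖ ^ 2 := by
    rw [inner_self_eq_norm_sq_to_K]; norm_cast
  have h5 : (⟪D (h - (t : ℂ) • D h), h - (t : ℂ) • D h⟫_ℂ).re
      = (⟪D h, h⟫_ℂ).re - 2 * t * ‖D h‖ ^ 2 + t ^ 2 * (⟪D (D h), D h⟫_ℂ).re := by
    simp only [map_sub, map_smul, inner_sub_left, inner_sub_right, inner_smul_left,
      inner_smul_right, h2, Complex.conj_ofReal, Complex.sub_re, Complex.re_ofReal_mul, h4]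
    ring
  have h1' : 0 ≤ (⟪D (h - (t : ℂ) • D h), h - (t : ℂ) • D h⟫_ℂ).re := h1
  rw [h5] at h1'
  have h6 : t * M = 1 := inv_mul_cancel₀ hM0.ne'
  have h7 : t ^ 2 * (⟪D (D h), D h⟫_ℂ).re ≤ t * ‖D h‖ ^ 2 := by
    calc t ^ 2 * (⟪D (D h), D h⟫_ℂ).re ≤ t ^ 2 * (M * ‖D h‖ ^ 2) := by gcongr
      _ = (t * M) * (t * ‖D h‖ ^ 2) := by ring
      _ = t * ‖D h‖ ^ 2 := by rw [h6, one_mul]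
  have h8 : t * ‖D h‖ ^ 2 ≤ (⟪D h, h⟫_ℂ).re := by linarith
  calc ‖D h‖ ^ 2 = M * (t * ‖D h‖ ^ 2) := by rw [← mul_assoc, mul_comm M, h6, one_mul]
    _ ≤ M * (⟪D h, h⟫_ℂ).re := by gcongr

/-- The infimum of the Rayleigh quotient `⟪A h, h⟫ / ⟪B h, h⟫` of two positive operators, `B`
compact and `A + B` coercive, is attained, and a minimizer solves `A h = lam B h`. -/
theorem exists_rayleigh_minimizer [CompleteSpace E] {A B : E →L[ℂ] E} (hA : A.IsPositive)
    (hB : B.IsPositive) (hBc : IsCompactOperator B) (hB0 : ∃ h, 0 < (⟪B h, h⟫_ℂ).re) {c : ℝ} (hc : 0 < c)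
    (hco : ∀ h, c * ‖h‖ ^ 2 ≤ (⟪A h, h⟫_ℂ).re + (⟪B h, h⟫_ℂ).re) :
    ∃ lam : ℝ, (∃ h, (⟪B h, h⟫_ℂ).re = 1 ∧ A h = (lam : ℂ) • B h) ∧
      ∀ v, lam * (⟪B v, v⟫_ℂ).re ≤ (⟪A v, v⟫_ℂ).re := by
  have hAnn : ∀ v, 0 ≤ (⟪A v, v⟫_ℂ).re := fun v => hA.re_inner_nonneg_left v
  have hBnn : ∀ v, 0 ≤ (⟪B v, v⟫_ℂ).re := fun v => hB.re_inner_nonneg_left v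
  have hscale : ∀ (T : E →L[ℂ] E) (t : ℝ) (v : E),
      (⟪T ((t : ℂ) • v), (t : ℂ) • v⟫_ℂ).re = t ^ 2 * (⟪T v, v⟫_ℂ).re := by
    intro T t v
    simp only [map_smul, inner_smul_left, inner_smul_right, Complex.conj_ofReal,
      Complex.re_ofReal_mul]
    ring
  have hnorm : ∀ v, 0 < (⟪B v, v⟫_ℂ).re →
      (⟪B (((√(⟪B v, v⟫_ℂ).re)⁻¹ : ℝ) • v : E), (((√(⟪B v, v⟫_ℂ).re)⁻¹ : ℝ) • v : E)⟫_ℂ).re = 1 ∧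
      (⟪A (((√(⟪B v, v⟫_ℂ).re)⁻¹ : ℝ) • v : E), (((√(⟪B v, v⟫_ℂ).re)⁻¹ : ℝ) • v : E)⟫_ℂ).re
        = (⟪A v, v⟫_ℂ).re / (⟪B v, v⟫_ℂ).re := by
    intro v hv
    have := hscale B (√(⟪B v, v⟫_ℂ).re)⁻¹ v
    have h2 := hscale A (√(⟪B v, v⟫_ℂ).re)⁻¹ v
    simp only [Complex.coe_smul] at this h2
    rw [this, h2, inv_pow, Real.sq_sqrt hv.le]
    exact ⟨inv_mul_cancel₀ hv.ne', by rw [div_eq_inv_mul]⟩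
  set S : Set ℝ := {q | ∃ h, (⟪B h, h⟫_ℂ).re = 1 ∧ q = (⟪A h, h⟫_ℂ).re} with hS
  have hSne : S.Nonempty := by
    obtain ⟨v, hv⟩ := hB0
    exact ⟨_, _, (hnorm v hv).1, rfl⟩
  have hSb : BddBelow S := ⟨0, by rintro q ⟨h, -, rfl⟩; exact hAnn h⟩
  set lam := sInf S with hlam
  have hle : ∀ v, lam * (⟪B v, v⟫_ℂ).re ≤ (⟪A v, v⟫_ℂ).re := by
    intro v
    rcases (hBnn v).eq_or_lt with h0 | h0
    · rw [← h0, mul_zero]; exact hAnn v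
    · have := csInf_le hSb ⟨_, (hnorm v h0).1, rfl⟩
      rw [(hnorm v h0).2, le_div_iff₀ h0] at this
      exact this
  refine ⟨lam, ?_, hle⟩
  set D : E →L[ℂ] E := A - (lam : ℂ) • B with hD
  have hDre : ∀ v, (⟪D v, v⟫_ℂ).re = (⟪A v, v⟫_ℂ).re - lam * (⟪B v, v⟫_ℂ).re := by
    intro v
    simp [hD]
  have hDpos : D.IsPositive := by
    rw [ContinuousLinearMap.isPositive_def']
    refine ⟨hA.isSelfAdjoint.sub ?_, fun v => ?_⟩
    · exact IsSelfAdjoint.smul (by simp [IsSelfAdjoint]) hB.isSelfAdjoint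
    · have : (⟪D v, v⟫_ℂ).re ≥ 0 := by rw [hDre]; linarith [hle v]
      exact this
  have hseq : ∀ n : ℕ, ∃ h, (⟪B h, h⟫_ℂ).re = 1 ∧ (⟪A h, h⟫_ℂ).re < lam + 1 / ((n : ℝ) + 1) := by
    intro n
    obtain ⟨q, ⟨h, h1, rfl⟩, hq⟩ := exists_lt_of_csInf_lt hSne
      (show sInf S < lam + 1 / ((n : ℝ) + 1) by
        rw [← hlam]; linarith [Nat.one_div_pos_of_nat (α := ℝ) (n := n)])
    exact ⟨h, h1, hq⟩
  choose h hB1 hAlt using hseq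
  -- By the choice of `lam`, `D = A - lam B` is positive, and its form tends to zero along the
  -- minimizing sequence.
  have hDh : Tendsto (fun n => D (h n)) atTop (𝓝 0) := by
    rw [tendsto_zero_iff_norm_tendsto_zero]
    have hsq : Tendsto (fun n => ‖D (h n)‖ ^ 2) atTop (𝓝 0) := by
      refine squeeze_zero (fun n => by positivity) (fun n =>
        (norm_sq_apply_le_of_isPositive hDpos (h n)).trans (mul_le_mul_of_nonneg_left (?_ : _ ≤ 1 / ((n : ℝ) + 1)) (by positivity))) ?_
      · rw [hDre, hB1]; linarith [hAlt n]
      · simpa using tendsto_one_div_add_atTop_nhds_zero_nat.const_mul (‖D‖ + 1)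
    simpa using hsq.sqrt
  -- Coercivity gives `c ‖h n‖² ≤ ⟪A h, h⟫ + 1`, and `⟪A h, h⟫` is below `lam + 1`.
  have hbd : ∀ n, h n ∈ Metric.closedBall (0 : E) (√((lam + 2) / c)) := by
    intro n
    rw [mem_closedBall_zero_iff]
    refine Real.le_sqrt_of_sq_le ?_
    rw [le_div_iff₀ hc]
    have h1 := hco (h n)
    have h2 := hAlt n
    have h3 : 1 / ((n : ℝ) + 1) ≤ 1 := by
      rw [div_le_one (by positivity)]; linarith [Nat.cast_nonneg (α := ℝ) n]
    rw [hB1] at h1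
    linarith
  obtain ⟨b, -, φ, hφ, hb⟩ := (hBc.isCompact_closure_image_closedBall (f := B.toLinearMap)
    (√((lam + 2) / c))).tendsto_subseq (x := fun n => B (h n)) (fun n => subset_closure ⟨h n, hbd n, rfl⟩)
  -- Since `A + B = D + (lam + 1) B`, convergence of `B h` along a subsequence makes `(A + B) h`
  -- converge. As `A + B` is bounded below, `h` itself then converges in norm, and no weak limits
  -- are needed.
  have hAB : Tendsto (fun n => (A + B) (h (φ n))) atTop (𝓝 (0 + ((lam + 1 : ℝ) : ℂ) • b)) := by
    have := (hDh.comp hφ.tendsto_atTop).add (hb.const_smul ((lam + 1 : ℝ) : ℂ))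
    refine this.congr fun n => ?_
    simp only [Function.comp, hD, sub_apply, smul_apply, add_apply, Complex.ofReal_add, add_smul,
      Complex.ofReal_one, one_smul]
    abel
  have hanti : AntilipschitzWith c.toNNReal⁻¹ (A + B) := by
    refine ContinuousLinearMap.antilipschitz_of_forall_le_inner_map (A + B)
      (Real.toNNReal_pos.mpr hc) fun x => ?_
    have h2 : (⟪(A + B) x, x⟫_ℂ).re = (⟪A x, x⟫_ℂ).re + (⟪B x, x⟫_ℂ).re := by simp
    rw [Real.coe_toNNReal c hc.le]
    linarith [hco x, Complex.re_le_norm ⟪(A + B) x, x⟫_ℂ]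
  have hcau : CauchySeq (fun n => h (φ n)) :=
    (hanti.isUniformInducing (A + B).uniformContinuous).cauchy_map_iff.1 hAB.cauchySeq
  obtain ⟨g, hg⟩ := cauchySeq_tendsto_of_complete hcau
  refine ⟨g, ?_, ?_⟩
  · have h1 : Tendsto (fun n => (⟪B (h (φ n)), h (φ n)⟫_ℂ).re) atTop (𝓝 (⟪B g, g⟫_ℂ).re) :=
      (Complex.continuous_re.tendsto _).comp (((B.continuous.tendsto g).comp hg).inner hg)
    simp only [hB1] at h1
    exact tendsto_nhds_unique h1 tendsto_const_nhds
  · have h1 : D g = 0 :=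
      tendsto_nhds_unique ((D.continuous.tendsto g).comp hg) (hDh.comp hφ.tendsto_atTop)
    simpa [hD, sub_eq_zero] using h1

end Hilbert

/-! ### Fundamental theorem of calculus for complex absolutely continuous functions. -/

section AbsolutelyContinuous

theorem _root_.LipschitzWith.comp_absolutelyContinuousOnInterval {X Y : Type*}
    [PseudoMetricSpace X] [PseudoMetricSpace Y] {φ : X → Y} {L : NNReal} (hφ : LipschitzWith L φ)
    {f : ℝ → X} {a b : ℝ} (hf : AbsolutelyContinuousOnInterval f a b) :
    AbsolutelyContinuousOnInterval (fun x => φ (f x)) a b := by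
  refine squeeze_zero (fun t => Finset.sum_nonneg fun i _ => dist_nonneg) (fun t => ?_)
    (by simpa using Tendsto.const_mul (L : ℝ) hf)
  rw [Finset.mul_sum]
  exact Finset.sum_le_sum fun i _ => hφ.dist_le_mul _ _

theorem _root_.AbsolutelyContinuousOnInterval.congr {X : Type*} [PseudoMetricSpace X]
    {f g : ℝ → X} {a b : ℝ} (hf : AbsolutelyContinuousOnInterval f a b)
    (h : EqOn f g (uIcc a b)) : AbsolutelyContinuousOnInterval g a b := by
  refine Tendsto.congr' ?_ hf
  filter_upwards [mem_inf_of_right (mem_principal_self _)]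
  rintro ⟨n, I⟩ hE
  refine Finset.sum_congr rfl fun i hi => ?_
  rw [h (hE.1 i hi).1, h (hE.1 i hi).2]

variable {f g : ℝ → ℂ} {a b : ℝ}

theorem ae_differentiableAt_of_ac (hf : AbsolutelyContinuousOnInterval f a b) :
    ∀ᵐ x, x ∈ uIcc a b → DifferentiableAt ℝ f x :=
  hf.boundedVariationOn.ae_differentiableAt_of_mem_uIcc

theorem absolutelyContinuousOnInterval_integral {c : ℝ} (h : IntervalIntegrable f volume a b)
    (hc : c ∈ uIcc a b) : AbsolutelyContinuousOnInterval (fun x => ∫ t in c..x, f t) a b := by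
  have hre : IntervalIntegrable (fun x => (f x).re) volume a b := ⟨h.1.re, h.2.re⟩
  have him : IntervalIntegrable (fun x => (f x).im) volume a b := ⟨h.1.im, h.2.im⟩
  have h1 := Complex.isometry_ofReal.lipschitz.comp_absolutelyContinuousOnInterval
    (hre.absolutelyContinuousOnInterval_intervalIntegral hc)
  have h2 := (Complex.isometry_ofReal.lipschitz.comp_absolutelyContinuousOnInterval
    (him.absolutelyContinuousOnInterval_intervalIntegral hc)).const_smul Complex.I
  refine (h1.add h2).congr fun x hx => ?_
  have hcx : IntervalIntegrable f volume c x := h.mono_set (uIcc_subset_uIcc hc hx)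
  have hcre : IntervalIntegrable (fun x => ((f x).re : ℂ)) volume c x :=
    ⟨hcx.1.re.ofReal, hcx.2.re.ofReal⟩
  have hcim : IntervalIntegrable (fun x => Complex.I * ((f x).im : ℂ)) volume c x :=
    ⟨hcx.1.im.ofReal.const_mul _, hcx.2.im.ofReal.const_mul _⟩
  simp only [Pi.add_apply, smul_eq_mul]
  rw [← intervalIntegral.integral_ofReal, ← intervalIntegral.integral_ofReal,
    ← intervalIntegral.integral_const_mul, ← intervalIntegral.integral_add hcre hcim]
  refine intervalIntegral.integral_congr fun t _ => ?_
  rw [mul_comm, Complex.re_add_im]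

theorem hasDerivAt_re {x : ℝ} {f' : ℂ} (h : HasDerivAt f f' x) :
    HasDerivAt (fun y => (f y).re) f'.re x :=
  (Complex.reCLM.hasFDerivAt.comp_hasDerivAt x h)

theorem hasDerivAt_im {x : ℝ} {f' : ℂ} (h : HasDerivAt f f' x) :
    HasDerivAt (fun y => (f y).im) f'.im x :=
  (Complex.imCLM.hasFDerivAt.comp_hasDerivAt x h)

theorem intervalIntegrable_deriv_of_ac (hf : AbsolutelyContinuousOnInterval f a b) :
    IntervalIntegrable (deriv f) volume a b := by
  have hre := (RCLike.lipschitzWith_re (K := ℂ)).comp_absolutelyContinuousOnInterval hf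
  have him := (RCLike.lipschitzWith_im (K := ℂ)).comp_absolutelyContinuousOnInterval hf
  have h1 := hre.intervalIntegrable_deriv
  have h2 := him.intervalIntegrable_deriv
  have h : IntervalIntegrable (fun x => ((deriv (fun y => (f y).re) x : ℝ) : ℂ) +
      ((deriv (fun y => (f y).im) x : ℝ) : ℂ) * Complex.I) volume a b :=
    IntervalIntegrable.add ⟨h1.1.ofReal, h1.2.ofReal⟩
      ⟨h2.1.ofReal.mul_const _, h2.2.ofReal.mul_const _⟩
  refine h.congr_ae ?_
  rw [EventuallyEq, ae_restrict_iff' measurableSet_uIoc]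
  filter_upwards [ae_differentiableAt_of_ac hf] with x hx hx'
  have hd := (hx (uIoc_subset_uIcc hx')).hasDerivAt
  rw [(hasDerivAt_re hd).deriv, (hasDerivAt_im hd).deriv, Complex.re_add_im]

/-- The difference of `f` and the primitive of its derivative is absolutely continuous with zero
derivative almost everywhere, hence constant. -/
theorem integral_deriv_of_ac (hf : AbsolutelyContinuousOnInterval f a b) :
    ∫ x in a..b, deriv f x = f b - f a := by
  have hP := absolutelyContinuousOnInterval_integral (c := a) (intervalIntegrable_deriv_of_ac hf)
    left_mem_uIcc
  obtain ⟨C, hC⟩ := (hf.sub hP).const_of_ae_hasDerivAt_zero (by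
    filter_upwards [ae_differentiableAt_of_ac hf,
      (intervalIntegrable_deriv_of_ac hf).ae_hasDerivAt_integral] with x h1 h2 hx
    simpa using (h1 hx).hasDerivAt.sub (h2 hx a left_mem_uIcc))
  have h1 := hC a left_mem_uIcc
  have h2 := hC b right_mem_uIcc
  simp only [Pi.sub_apply, intervalIntegral.integral_same, sub_zero] at h1 h2
  rw [h1, ← h2]; ring

end AbsolutelyContinuous

/-! ### Integration and multiplication operators on `L²` of the cell. -/

section Operators

/-- Lebesgue measure on the unit cell. -/
abbrev cellMeasure : Measure ℝ := volume.restrict (Ioc (0 : ℝ) 1)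

/-- Square integrable functions on the unit cell. -/
abbrev CellL2 : Type := Lp ℂ 2 cellMeasure

/-- The indicator function of `(-∞, y]`. -/
def ind (y : ℝ) : CellL2 :=
  indicatorConstLp 2 (measurableSet_Iic (a := y)) (measure_ne_top _ _) (1 : ℂ)

theorem restrict_Icc_eq_cellMeasure : volume.restrict (Icc (0 : ℝ) 1) = cellMeasure :=
  Measure.restrict_congr_set Ioc_ae_eq_Icc.symm

theorem integral_cellMeasure {E : Type*} [NormedAddCommGroup E] [NormedSpace ℝ E] (f : ℝ → E) :
    ∫ y, f y ∂cellMeasure = ∫ y in (0 : ℝ)..1, f y :=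
  (intervalIntegral.integral_of_le zero_le_one).symm

theorem ae_cellMeasure_of_ae {p : ℝ → Prop} (h : ∀ᵐ y, y ∈ uIcc (0 : ℝ) 1 → p y) :
    ∀ᵐ y ∂cellMeasure, p y := by
  rw [ae_restrict_iff' measurableSet_Ioc]
  filter_upwards [h] with y hy hy'
  exact hy (by rw [uIcc_of_le zero_le_one]; exact Ioc_subset_Icc_self hy')

theorem ae_of_ae_cellMeasure {p : ℝ → Prop} (h : ∀ᵐ y ∂cellMeasure, p y) :
    ∀ᵐ y, y ∈ uIcc (0 : ℝ) 1 → p y := by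
  rw [← restrict_Icc_eq_cellMeasure, ae_restrict_iff' measurableSet_Icc] at h
  rwa [uIcc_of_le zero_le_one]

theorem ae_mem_Icc : ∀ᵐ y ∂cellMeasure, y ∈ Icc (0 : ℝ) 1 := by
  filter_upwards [ae_restrict_mem measurableSet_Ioc] with y hy using Ioc_subset_Icc_self hy

theorem measureReal_cellMeasure_univ : cellMeasure.real univ = 1 := by
  simp [measureReal_def]

theorem memLp_of_continuousOn {f : ℝ → ℂ} (hf : ContinuousOn f (Icc 0 1)) {p : ℝ≥0∞} :
    MemLp f p cellMeasure := by
  obtain ⟨C, hC⟩ := isCompact_Icc.exists_bound_of_continuousOn hf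
  refine MemLp.of_bound ?_ C (by filter_upwards [ae_mem_Icc] with y hy using hC y hy)
  rw [← restrict_Icc_eq_cellMeasure]
  exact hf.aestronglyMeasurable measurableSet_Icc

theorem memLp_of_ac {f : ℝ → ℂ} (hf : AbsolutelyContinuousOnInterval f 0 1) {p : ℝ≥0∞} :
    MemLp f p cellMeasure :=
  memLp_of_continuousOn (by simpa [uIcc_of_le zero_le_one] using hf.continuousOn)

theorem integrable_cellL2 (g : CellL2) : Integrable g cellMeasure :=
  (Lp.memLp g).integrable one_le_two

theorem intervalIntegrable_cellL2 (g : CellL2) : IntervalIntegrable g volume 0 1 :=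
  (intervalIntegrable_iff_integrableOn_Ioc_of_le zero_le_one).2 (integrable_cellL2 g)

theorem inner_cellL2 (f g : CellL2) :
    ⟪f, g⟫_ℂ = ∫ y, starRingEnd ℂ (f y) * g y ∂cellMeasure := by
  rw [L2.inner_def]
  simp [RCLike.inner_apply, mul_comm]

theorem norm_sq_cellL2 (f : CellL2) : ‖f‖ ^ 2 = ∫ y, ‖f y‖ ^ 2 ∂cellMeasure := by
  have h : ((‖f‖ ^ 2 : ℝ) : ℂ) = ((∫ y, ‖f y‖ ^ 2 ∂cellMeasure : ℝ) : ℂ) := by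
    rw [← integral_complex_ofReal]
    have := inner_self_eq_norm_sq_to_K (𝕜 := ℂ) f
    push_cast
    rw [inner_cellL2] at this
    rw [← Complex.coe_algebraMap]
    refine this.symm.trans ?_
    refine integral_congr_ae (Eventually.of_forall fun y => ?_)
    simp only
    rw [mul_comm, Complex.mul_conj, Complex.normSq_eq_norm_sq]
    push_cast; rfl
  exact_mod_cast h

/-- Writing the primitive as an inner product with `ind y` reduces its continuity, bounds and
equicontinuity to those of the curve `y ↦ ind y` in `L²`. In particular `ind 1` plays the role of
the constant function `1`. -/
theorem inner_ind {y : ℝ} (hy : y ∈ Icc (0 : ℝ) 1) (g : CellL2) :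
    ⟪ind y, g⟫_ℂ = ∫ t in (0 : ℝ)..y, g t := by
  rw [ind, L2.inner_indicatorConstLp_one, intervalIntegral.integral_of_le hy.1,
    Measure.restrict_restrict measurableSet_Iic]
  congr 2
  ext t
  simp only [mem_inter_iff, mem_Iic, mem_Ioc]
  constructor
  · rintro ⟨h1, h2, -⟩; exact ⟨h2, h1⟩
  · rintro ⟨h1, h2⟩; exact ⟨h2, h1, h2.trans hy.2⟩

theorem inner_ind_zero (g : CellL2) : ⟪ind 0, g⟫_ℂ = 0 := by
  rw [inner_ind (left_mem_Icc.2 zero_le_one), intervalIntegral.integral_same]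

theorem coeFn_ind_one : ind 1 =ᵐ[cellMeasure] fun _ => (1 : ℂ) := by
  filter_upwards [indicatorConstLp_coeFn (p := 2) (hs := measurableSet_Iic (a := (1 : ℝ)))
    (hμs := measure_ne_top cellMeasure _) (c := (1 : ℂ)), ae_mem_Icc] with y hy hy'
  rw [ind, hy, indicator_of_mem (mem_Iic.2 hy'.2)]

theorem norm_ind_le (y : ℝ) : ‖ind y‖ ≤ 1 := by
  rw [ind, norm_indicatorConstLp two_ne_zero ENNReal.ofNat_ne_top, norm_one, one_mul]
  refine Real.rpow_le_one measureReal_nonneg ?_ (by positivity)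
  exact (measureReal_mono (subset_univ _)).trans measureReal_cellMeasure_univ.le

theorem inner_ind_one_self : ⟪ind 1, ind 1⟫_ℂ = 1 := by
  rw [inner_ind (right_mem_Icc.2 zero_le_one), ← integral_cellMeasure,
    integral_congr_ae coeFn_ind_one]
  simp

theorem continuous_ind : Continuous ind := by
  refine continuous_indicatorConstLp_set ENNReal.ofNat_ne_top fun x => ?_
  have h : Tendsto (fun y : ℝ => ENNReal.ofReal |y - x|) (𝓝 x) (𝓝 0) := by
    have h1 : Tendsto (fun y : ℝ => |y - x|) (𝓝 x) (𝓝 0) := by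
      have : Continuous fun y : ℝ => |y - x| := by fun_prop
      simpa using this.tendsto x
    simpa using ENNReal.tendsto_ofReal h1
  refine tendsto_of_tendsto_of_tendsto_of_le_of_le tendsto_const_nhds h (fun _ => zero_le)
    fun y => ?_
  refine (Measure.restrict_apply_le _ _).trans ?_
  have hsub : (Iic y ∆ Iic x : Set ℝ) ⊆ uIoc x y := by
    intro t ht
    rcases ht with ⟨h1, h2⟩ | ⟨h1, h2⟩
    · simp only [mem_Iic, not_le] at h1 h2
      exact mem_uIoc.2 (Or.inl ⟨h2, h1⟩)
    · simp only [mem_Iic, not_le] at h1 h2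
      exact mem_uIoc.2 (Or.inr ⟨h2, h1⟩)
  refine (measure_mono hsub).trans ?_
  rw [uIoc, Real.volume_Ioc, max_sub_min_eq_abs]

theorem prim_continuous (g : CellL2) : Continuous fun y => ⟪ind y, g⟫_ℂ :=
  continuous_ind.inner continuous_const

theorem prim_ac (g : CellL2) :
    AbsolutelyContinuousOnInterval (fun y => ⟪ind y, g⟫_ℂ) 0 1 := by
  refine (absolutelyContinuousOnInterval_integral (intervalIntegrable_cellL2 g)
    left_mem_uIcc).congr fun y hy => ?_
  rw [uIcc_of_le zero_le_one] at hy
  exact (inner_ind hy g).symm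

theorem prim_hasDerivAt (g : CellL2) :
    ∀ᵐ y ∂cellMeasure, HasDerivAt (fun y => ⟪ind y, g⟫_ℂ) (g y) y := by
  have h1 := ae_cellMeasure_of_ae (by
    filter_upwards [(intervalIntegrable_cellL2 g).ae_hasDerivAt_integral] with x hx hx'
    exact hx hx' 0 left_mem_uIcc)
  -- The formula `inner_ind` holds on `[0,1]` only, so differentiating needs a neighbourhood inside;
  -- the endpoints form a null set.
  have h2 : ∀ᵐ y ∂cellMeasure, y ∈ Ioo (0 : ℝ) 1 := by
    rw [cellMeasure, Measure.restrict_congr_set Ioo_ae_eq_Ioc.symm]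
    exact ae_restrict_mem measurableSet_Ioo
  filter_upwards [h1, h2] with y hy hy'
  refine hy.congr_of_eventuallyEq ?_
  filter_upwards [isOpen_Ioo.mem_nhds hy'] with t ht
  exact inner_ind (Ioo_subset_Icc_self ht) g

theorem eq_add_prim {u : ℝ → ℂ} (hu : AbsolutelyContinuousOnInterval u 0 1)
    (hu' : MemLp (deriv u) 2 cellMeasure) {y : ℝ} (hy : y ∈ Icc (0 : ℝ) 1) :
    u y = u 0 + ⟪ind y, hu'.toLp⟫_ℂ := by
  have h1 : ∫ t in (0 : ℝ)..y, (hu'.toLp : CellL2) t = ∫ t in (0 : ℝ)..y, deriv u t := by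
    refine intervalIntegral.integral_congr_ae ?_
    filter_upwards [ae_of_ae_cellMeasure hu'.coeFn_toLp] with t ht ht'
    rw [uIoc_of_le hy.1] at ht'
    refine ht ?_
    rw [uIcc_of_le zero_le_one]
    exact ⟨ht'.1.le, ht'.2.trans hy.2⟩
  have hu2 : AbsolutelyContinuousOnInterval u 0 y := hu.mono (uIcc_subset_uIcc left_mem_uIcc
    (by rwa [uIcc_of_le zero_le_one]))
  rw [inner_ind hy, h1, integral_deriv_of_ac hu2]; ring

/-- Restriction of `y ↦ ⟪ind y, g⟫` to the closed unit cell, as a bounded linear operator. -/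
def primC : CellL2 →L[ℂ] (Icc (0 : ℝ) 1 →ᵇ ℂ) :=
  LinearMap.mkContinuous
    { toFun := fun g => BoundedContinuousFunction.mkOfCompact
        ⟨fun y => ⟪ind y, g⟫_ℂ, (prim_continuous g).comp continuous_subtype_val⟩
      map_add' := fun f g => by ext y; simp [inner_add_right]
      map_smul' := fun c g => by ext y; simp [inner_smul_right] } 1 (fun g => by
    rw [one_mul, BoundedContinuousFunction.norm_le (norm_nonneg _)]
    intro y
    exact (norm_inner_le_norm _ _).trans
      (mul_le_of_le_one_left (norm_nonneg _) (norm_ind_le _)))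

theorem primC_apply (g : CellL2) (y : Icc (0 : ℝ) 1) : primC g y = ⟪ind y, g⟫_ℂ := rfl

/-- Inclusion of the continuous functions on the closed unit cell into `CellL2`. -/
def inclL2 : (Icc (0 : ℝ) 1 →ᵇ ℂ) →L[ℂ] CellL2 :=
  (BoundedContinuousFunction.toLp 2 cellMeasure ℂ).comp
    (LinearMap.mkContinuous (σ := RingHom.id ℂ)
      { toFun := fun f => f.compContinuous ⟨projIcc (0 : ℝ) 1 zero_le_one, continuous_projIcc⟩
        map_add' := fun f g => by ext; simp
        map_smul' := fun c g => by ext; simp } 1 (fun f => by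
      rw [one_mul, BoundedContinuousFunction.norm_le (norm_nonneg _)]
      intro y
      exact f.norm_coe_le_norm _))

/-- The operator of integration from `0`. -/
def prim : CellL2 →L[ℂ] CellL2 := inclL2.comp primC

theorem coeFn_prim (g : CellL2) : prim g =ᵐ[cellMeasure] fun y => ⟪ind y, g⟫_ℂ := by
  have h := BoundedContinuousFunction.coeFn_toLp (p := 2) (𝕜 := ℂ) cellMeasure
    ((primC g).compContinuous ⟨projIcc (0 : ℝ) 1 zero_le_one, continuous_projIcc⟩)
  filter_upwards [h, ae_mem_Icc] with y hy hy'
  change (BoundedContinuousFunction.toLp 2 cellMeasure ℂ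
    ((primC g).compContinuous ⟨projIcc (0 : ℝ) 1 zero_le_one, continuous_projIcc⟩)) y = _
  rw [hy]
  simp [primC_apply, projIcc_of_mem zero_le_one hy']

/-- Arzelà–Ascoli: on the unit ball the modulus of continuity `‖ind x - ind y‖` does not depend on
`g`. -/
theorem isCompactOperator_primC : IsCompactOperator primC := by
  refine (isCompactOperator_iff_isCompact_closure_image_closedBall (𝕜₁ := ℂ)
    primC.toLinearMap zero_lt_one).2 ?_
  refine BoundedContinuousFunction.arzela_ascoli (Metric.closedBall (0 : ℂ) 1)
    (isCompact_closedBall _ _) _ ?_ ?_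
  · rintro - y ⟨g, hg, rfl⟩
    rw [mem_closedBall_zero_iff] at hg ⊢
    exact (norm_inner_le_norm _ _).trans (mul_le_one₀ (norm_ind_le _) (norm_nonneg _) hg)
  · intro x
    refine Metric.equicontinuousAt_of_continuity_modulus
      (fun y : Icc (0 : ℝ) 1 => ‖ind x - ind y‖) ?_ _ (Eventually.of_forall fun y => ?_)
    · have : Continuous fun y : Icc (0 : ℝ) 1 => ‖ind x - ind y‖ :=
        (continuous_const.sub (continuous_ind.comp continuous_subtype_val)).norm
      simpa using this.tendsto x
    · rintro ⟨-, g, hg, rfl⟩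
      rw [mem_closedBall_zero_iff] at hg
      change dist ⟪ind x, g⟫_ℂ ⟪ind y, g⟫_ℂ ≤ _
      rw [dist_eq_norm, ← inner_sub_left]
      exact (norm_inner_le_norm _ _).trans (mul_le_of_le_one_right (norm_nonneg _) hg)

theorem isCompactOperator_prim : IsCompactOperator prim :=
  isCompactOperator_primC.clm_comp inclL2

/-- Integration by parts. -/
theorem inner_prim_add_inner_prim (f g : CellL2) :
    ⟪prim f, g⟫_ℂ + ⟪f, prim g⟫_ℂ = ⟪f, ind 1⟫_ℂ * ⟪ind 1, g⟫_ℂ := by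
  have hu := Complex.isometry_conj.lipschitz.comp_absolutelyContinuousOnInterval (prim_ac f)
  have hv := prim_ac g
  have huv := hu.smul hv
  have h1 := integral_deriv_of_ac huv
  simp only [Pi.smul_apply', smul_eq_mul, inner_ind_zero, mul_zero, sub_zero] at h1
  rw [inner_conj_symm] at h1
  rw [← h1, ← integral_cellMeasure, inner_cellL2, inner_cellL2, ← integral_add]
  · refine integral_congr_ae ?_
    filter_upwards [prim_hasDerivAt f, prim_hasDerivAt g, coeFn_prim f, coeFn_prim g]
      with y h1 h2 h3 h4
    have h5 := ((Complex.conjCLE.toContinuousLinearMap.hasFDerivAt.comp_hasDerivAt y h1).mul h2)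
    refine Eq.trans ?_ h5.deriv.symm
    simp only [h3, h4, Function.comp]
    rw [add_comm]
    rfl
  · simpa [RCLike.inner_apply, mul_comm] using L2.integrable_inner (𝕜 := ℂ) (prim f) g
  · simpa [RCLike.inner_apply, mul_comm] using L2.integrable_inner (𝕜 := ℂ) f (prim g)

/-- Multiplication by an essentially bounded real function. -/
def mulOp (m : ℝ → ℝ) (hm : MemLp m ∞ cellMeasure) : CellL2 →L[ℂ] CellL2 :=
  (ContinuousLinearMap.mul ℂ ℂ).holderL cellMeasure ∞ 2 2 (hm.ofReal (K := ℂ)).toLp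

variable {m : ℝ → ℝ} (hm : MemLp m ∞ cellMeasure)

theorem coeFn_mulOp (g : CellL2) : mulOp m hm g =ᵐ[cellMeasure] fun y => (m y : ℂ) * g y := by
  filter_upwards [(ContinuousLinearMap.mul ℂ ℂ).coeFn_holder (r := 2)
    (hm.ofReal (K := ℂ)).toLp g, (hm.ofReal (K := ℂ)).coeFn_toLp] with y h1 h2
  refine Eq.trans h1 ?_
  rw [h2]; rfl

theorem inner_mulOp (f g : CellL2) :
    ⟪mulOp m hm f, g⟫_ℂ = ∫ y, (m y : ℂ) * (starRingEnd ℂ (f y) * g y) ∂cellMeasure := by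
  rw [inner_cellL2]
  refine integral_congr_ae ?_
  filter_upwards [coeFn_mulOp hm f] with y hy
  rw [hy, map_mul, Complex.conj_ofReal, mul_assoc]

theorem inner_mulOp_right (f g : CellL2) : ⟪f, mulOp m hm g⟫_ℂ = ⟪mulOp m hm f, g⟫_ℂ := by
  rw [inner_mulOp, inner_cellL2]
  refine integral_congr_ae ?_
  filter_upwards [coeFn_mulOp hm g] with y hy
  rw [hy]; ring

theorem inner_mulOp_self (f : CellL2) :
    ⟪mulOp m hm f, f⟫_ℂ = ((∫ y, m y * ‖f y‖ ^ 2 ∂cellMeasure : ℝ) : ℂ) := by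
  rw [inner_mulOp, ← integral_complex_ofReal]
  refine integral_congr_ae (Eventually.of_forall fun y => ?_)
  simp only
  rw [mul_comm (starRingEnd ℂ _), Complex.mul_conj, Complex.normSq_eq_norm_sq]
  push_cast; rfl

theorem isPositive_mulOp (h0 : ∀ᵐ y ∂cellMeasure, 0 ≤ m y) : (mulOp m hm).IsPositive := by
  refine ContinuousLinearMap.isPositive_def.2
    ⟨fun f g => (inner_mulOp_right hm f g).symm, fun f => ?_⟩
  change 0 ≤ (⟪mulOp m hm f, f⟫_ℂ).re
  rw [inner_mulOp_self, Complex.ofReal_re]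
  refine integral_nonneg_of_ae ?_
  filter_upwards [h0] with y hy using by positivity

end Operators

/-! ### Boundedness and measurability of piecewise continuous coefficients. -/

section Coefficients

/-- The one-sided limits bound `f` on either side of each point, the value at the point is added by
hand, and compactness glues the local bounds. -/
theorem PiecewiseContinuous.exists_bound {f : ℝ → ℝ} (hf : PiecewiseContinuous f) :
    ∃ C, ∀ y ∈ Icc (0 : ℝ) 1, |f y| ≤ C := by
  refine isCompact_Icc.induction_on (p := fun s => ∃ C, ∀ y ∈ s, |f y| ≤ C) ⟨0, by simp⟩
    (fun s t hst ⟨C, hC⟩ => ⟨C, fun y hy => hC y (hst hy)⟩)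
    (fun s t ⟨C, hC⟩ ⟨D, hD⟩ => ⟨max C D, ?_⟩) fun x _ => ?_
  · rintro y (hy | hy)
    · exact (hC y hy).trans (le_max_left _ _)
    · exact (hD y hy).trans (le_max_right _ _)
  · obtain ⟨⟨l, hl⟩, r, hr⟩ := hf.2 x
    have h1 : ∀ᶠ y in 𝓝[<] x, |f y| ≤ |l| + 1 :=
      (hl.abs.eventually_lt_const (lt_add_one _)).mono fun _ h => h.le
    have h2 : ∀ᶠ y in 𝓝[>] x, |f y| ≤ |r| + 1 :=
      (hr.abs.eventually_lt_const (lt_add_one _)).mono fun _ h => h.le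
    refine ⟨{y | |f y| ≤ max (max (|l| + 1) (|r| + 1)) |f x|}, mem_nhdsWithin_of_mem_nhds ?_,
      _, fun y hy => hy⟩
    rw [eventually_nhdsWithin_iff] at h1 h2
    filter_upwards [h1, h2] with y hy1 hy2
    rcases lt_trichotomy y x with h | h | h
    · exact (hy1 h).trans ((le_max_left _ _).trans (le_max_left _ _))
    · subst h; exact le_max_right _ _
    · exact (hy2 h).trans ((le_max_right _ _).trans (le_max_left _ _))

theorem PiecewiseContinuous.memLp_top {f : ℝ → ℝ} (hf : PiecewiseContinuous f) :
    MemLp f ∞ cellMeasure := by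
  obtain ⟨C, hC⟩ := hf.exists_bound
  refine MemLp.of_bound ?_ C (by filter_upwards [ae_mem_Icc] with y hy using hC y hy)
  -- Measurability: `f` is continuous on the cell minus the finite, hence null, set `S`.
  set S := {x ∈ Icc (0 : ℝ) 1 | ¬ ContinuousAt f x}
  have hS : S.Finite := hf.1 0 1
  have h1 : ContinuousOn f (Icc 0 1 \ S) := fun x hx =>
    (not_not.1 fun h => hx.2 ⟨hx.1, h⟩ : ContinuousAt f x).continuousWithinAt
  have h2 := h1.aestronglyMeasurable (μ := volume) (measurableSet_Icc.diff hS.measurableSet)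
  rwa [Measure.restrict_congr_set (sdiff_null_ae_eq_self (hS.measure_zero _)),
    restrict_Icc_eq_cellMeasure] at h2

theorem IsCoefficient.memLp_top {f : ℝ → ℝ} (hf : IsCoefficient f) : MemLp f ∞ cellMeasure :=
  hf.piecewiseContinuous.memLp_top

theorem IsCoefficient.pos {f : ℝ → ℝ} (hf : IsCoefficient f) (y : ℝ) : 0 < f y := by
  obtain ⟨c, hc, h⟩ := hf.strictlyPositive
  exact hc.trans_le (h y)

theorem IsCoefficient.mean_pos {f : ℝ → ℝ} (hf : IsCoefficient f) : 0 < mean f := by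
  refine intervalIntegral.intervalIntegral_pos_of_pos ?_ hf.pos zero_lt_one
  rw [intervalIntegrable_iff_integrableOn_Ioc_of_le zero_le_one]
  exact hf.memLp_top.integrable le_top

theorem integrable_mul_norm_sq {m : ℝ → ℝ} (hm : MemLp m ∞ cellMeasure) {u : ℝ → ℂ}
    (hu : MemLp u 2 cellMeasure) : Integrable (fun y => m y * ‖u y‖ ^ 2) cellMeasure :=
  memLp_one_iff_integrable.1
    ((memLp_one_iff_integrable.2 (memLp_two_iff_integrable_sq_norm hu.1 |>.1 hu)).mul hm)

end Coefficients

/-! ### Parametrising quasi-periodic functions by `L²`. -/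

section Form

/-- The kinetic and potential energy of a displacement `u`. -/
def energy (μ₁ μ₂ : ℝ → ℝ) (k : ℝ) (u : ℝ → ℂ) : ℝ :=
  ∫ y, μ₁ y * ‖deriv u y‖ ^ 2 ∂cellMeasure + k ^ 2 * ∫ y, μ₂ y * ‖u y‖ ^ 2 ∂cellMeasure

/-- The weighted square norm of a displacement `u`. -/
def mass (ρ : ℝ → ℝ) (u : ℝ → ℂ) : ℝ := ∫ y, ρ y * ‖u y‖ ^ 2 ∂cellMeasure

/-- The quasi-periodicity parameter `2 - exp (i K)`. -/
def bloch (K : ℝ) : ℂ := 2 - Complex.exp (Complex.I * K)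

theorem conj_bloch (K : ℝ) : starRingEnd ℂ (bloch K) = 2 - Complex.exp (-(Complex.I * K)) := by
  simp [bloch, ← Complex.exp_conj, Complex.conj_ofNat]

/-- The derivative of the quasi-periodic function parametrised by `h`. -/
def gradOp (K : ℝ) : CellL2 →L[ℂ] CellL2 :=
  ContinuousLinearMap.id ℂ CellL2 - bloch K • (innerSL ℂ (ind 1)).smulRight (ind 1)

theorem gradOp_apply (K : ℝ) (h : CellL2) :
    gradOp K h = h - (bloch K * ⟪ind 1, h⟫_ℂ) • ind 1 := by
  simp [gradOp, smul_smul]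

/-- The quasi-periodic function parametrised by `h`. -/
def valOp (K : ℝ) : CellL2 →L[ℂ] CellL2 :=
  (innerSL ℂ (ind 1)).smulRight (ind 1) + prim.comp (gradOp K)

theorem valOp_apply (K : ℝ) (h : CellL2) :
    valOp K h = ⟪ind 1, h⟫_ℂ • ind 1 + prim (gradOp K h) := by
  simp [valOp]

theorem coeFn_valOp (K : ℝ) (h : CellL2) :
    valOp K h =ᵐ[cellMeasure] fun y => ⟪ind 1, h⟫_ℂ + ⟪ind y, gradOp K h⟫_ℂ := by
  rw [valOp_apply]
  filter_upwards [Lp.coeFn_add (⟪ind 1, h⟫_ℂ • ind 1) (prim (gradOp K h)),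
    Lp.coeFn_smul ⟪ind 1, h⟫_ℂ (ind 1), coeFn_ind_one, coeFn_prim (gradOp K h)] with y h1 h2 h3 h4
  rw [h1, Pi.add_apply, h2, Pi.smul_apply, h3, h4, smul_eq_mul, mul_one]

/-- This is the condition `u(1) = exp (iK) u(0)`: the mean of `u'` is `(1 - bloch K) u(0)`, which
explains the constant `2 - exp (iK)`. The choice works uniformly in `K`, including the periodic
case. -/
theorem inner_ind_one_gradOp (K : ℝ) (h : CellL2) :
    ⟪ind 1, h⟫_ℂ + ⟪ind 1, gradOp K h⟫_ℂ = Complex.exp (Complex.I * K) * ⟪ind 1, h⟫_ℂ := by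
  rw [gradOp_apply, inner_sub_right, inner_smul_right, inner_ind_one_self, bloch]
  ring

theorem isCompactOperator_valOp (K : ℝ) : IsCompactOperator (valOp K) := by
  refine IsCompactOperator.add (f := (innerSL ℂ (ind 1)).smulRight (ind 1)) ?_
    (isCompactOperator_prim.comp_clm (gradOp K))
  have h1 : IsCompactOperator (innerSL ℂ (ind 1) : CellL2 →L[ℂ] ℂ) :=
    isCompactOperator_of_locallyCompactSpace_dom (innerSL ℂ (ind 1) : CellL2 →L[ℂ] ℂ)
  exact h1.clm_comp (ContinuousLinearMap.toSpanSingleton ℂ (ind 1))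

/-- Coercivity: `h` is `gradOp K h` plus `bloch K` times the constant `⟪ind 1, h⟫`, and that
constant function is `valOp K h` minus the primitive of `gradOp K h`. -/
theorem norm_le_gradOp_valOp (K : ℝ) : ∃ L : ℝ, 0 < L ∧ ∀ h : CellL2,
    ‖h‖ ^ 2 ≤ L * (‖gradOp K h‖ ^ 2 + ‖valOp K h‖ ^ 2) := by
  set L : ℝ := 1 + ‖bloch K‖ * (1 + ‖prim‖) with hL
  refine ⟨2 * L ^ 2, by positivity, fun h => ?_⟩
  have h1 : ‖⟪ind 1, h⟫_ℂ • ind 1‖ ≤ ‖valOp K h‖ + ‖prim‖ * ‖gradOp K h‖ := by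
    have : ⟪ind 1, h⟫_ℂ • ind 1 = valOp K h - prim (gradOp K h) := by
      rw [valOp_apply, add_sub_cancel_right]
    rw [this]
    exact (norm_sub_le _ _).trans (by gcongr; exact prim.le_opNorm _)
  have h2 : ‖h‖ ≤ ‖gradOp K h‖ + ‖bloch K‖ * ‖⟪ind 1, h⟫_ℂ • ind 1‖ := by
    have : h = gradOp K h + bloch K • (⟪ind 1, h⟫_ℂ • ind 1) := by
      rw [gradOp_apply, smul_smul, sub_add_cancel]
    rw [← norm_smul]
    nth_rw 1 [this]
    exact norm_add_le _ _
  have h3 : ‖h‖ ≤ L * (‖gradOp K h‖ + ‖valOp K h‖) := by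
    refine h2.trans ((add_le_add_right (mul_le_mul_of_nonneg_left h1 (norm_nonneg _)) _).trans ?_)
    rw [hL]
    have := norm_nonneg (gradOp K h)
    have := norm_nonneg (valOp K h)
    have := norm_nonneg (bloch K)
    have := norm_nonneg prim
    have : 0 ≤ ‖bloch K‖ * ‖prim‖ * ‖valOp K h‖ := by positivity
    nlinarith [mul_nonneg (norm_nonneg (bloch K)) (norm_nonneg (gradOp K h))]
  calc ‖h‖ ^ 2 ≤ (L * (‖gradOp K h‖ + ‖valOp K h‖)) ^ 2 := by gcongr
    _ ≤ 2 * L ^ 2 * (‖gradOp K h‖ ^ 2 + ‖valOp K h‖ ^ 2) := by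
      nlinarith [mul_nonneg (sq_nonneg L) (sq_nonneg (‖gradOp K h‖ - ‖valOp K h‖))]

/-- Surjectivity of the parametrisation, with `h = u' + bloch K * u(0)`; then `⟪ind 1, h⟫ = u(0)`.
It lets a bound for all `h` be read as a bound for all trial functions. -/
theorem exists_param {K : ℝ} {u : ℝ → ℂ} (hu : AbsolutelyContinuousOnInterval u 0 1)
    (hu' : MemLp (deriv u) 2 cellMeasure) (hbc : u 1 = Complex.exp (Complex.I * K) * u 0) :
    ∃ h : CellL2, gradOp K h =ᵐ[cellMeasure] deriv u ∧ valOp K h =ᵐ[cellMeasure] u := by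
  set g : CellL2 := hu'.toLp with hg
  have h1 : ⟪ind 1, g⟫_ℂ = (Complex.exp (Complex.I * K) - 1) * u 0 := by
    have := eq_add_prim hu hu' (right_mem_Icc.2 zero_le_one)
    rw [hbc] at this
    linear_combination -this
  have h2 : ⟪ind 1, g + (bloch K * u 0) • ind 1⟫_ℂ = u 0 := by
    rw [inner_add_right, inner_smul_right, inner_ind_one_self, h1, bloch]; ring
  have h3 : gradOp K (g + (bloch K * u 0) • ind 1) = g := by
    rw [gradOp_apply, h2, add_sub_cancel_right]
  refine ⟨g + (bloch K * u 0) • ind 1, by rw [h3]; exact hu'.coeFn_toLp, ?_⟩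
  filter_upwards [coeFn_valOp K (g + (bloch K * u 0) • ind 1), ae_mem_Icc] with y hy hy'
  rw [hy, h2, h3, ← eq_add_prim hu hu' hy']

end Form

/-! ### The minimizer is an eigenfunction. -/

section GroundState

variable {ρ μ₁ μ₂ : ℝ → ℝ}

theorem integral_mul_norm_sq_congr (m : ℝ → ℝ) {f g : ℝ → ℂ} (h : f =ᵐ[cellMeasure] g) :
    ∫ y, m y * ‖f y‖ ^ 2 ∂cellMeasure = ∫ y, m y * ‖g y‖ ^ 2 ∂cellMeasure := by
  refine integral_congr_ae ?_
  filter_upwards [h] with y hy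
  rw [hy]

theorem IsCoefficient.mul_norm_sq_le {m : ℝ → ℝ} (hm : IsCoefficient m) : ∃ c : ℝ, 0 < c ∧
    ∀ f : CellL2, c * ‖f‖ ^ 2 ≤ ∫ y, m y * ‖f y‖ ^ 2 ∂cellMeasure := by
  obtain ⟨c, hc, h⟩ := hm.strictlyPositive
  refine ⟨c, hc, fun f => ?_⟩
  rw [norm_sq_cellL2, ← integral_const_mul]
  refine integral_mono ?_ (integrable_mul_norm_sq hm.memLp_top (Lp.memLp f)) fun y =>
    mul_le_mul_of_nonneg_right (h y) (by positivity)
  exact ((memLp_two_iff_integrable_sq_norm (Lp.memLp f).1).1 (Lp.memLp f)).const_mul c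

theorem hasDerivAt_cexp_I_mul (K y : ℝ) : HasDerivAt (fun y : ℝ => Complex.exp (Complex.I * K * y))
    (Complex.I * K * Complex.exp (Complex.I * K * y)) y := by
  have h : HasDerivAt (fun y : ℝ => Complex.I * K * (y : ℂ)) (Complex.I * K * 1) y :=
    (Complex.ofRealCLM.hasDerivAt (x := y)).const_mul (Complex.I * (K : ℂ))
  convert h.cexp using 1
  ring

theorem norm_cexp_I_mul (K y : ℝ) : ‖Complex.exp (Complex.I * K * y)‖ = 1 := by
  rw [mul_assoc, mul_comm, ← Complex.ofReal_mul, Complex.norm_exp_ofReal_mul_I]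

theorem contDiff_cexp_I_mul (K : ℝ) : ContDiff ℝ 1 (fun y : ℝ => Complex.exp (Complex.I * K * y)) :=
  (contDiff_const.mul Complex.ofRealCLM.contDiff).cexp

theorem exists_valOp_ne_zero (K : ℝ) : ∃ h, valOp K h ≠ 0 := by
  have hac := (contDiff_cexp_I_mul K).contDiffOn.absolutelyContinuousOnInterval (a := 0) (b := 1)
  have hd : MemLp (deriv fun y : ℝ => Complex.exp (Complex.I * K * y)) 2 cellMeasure :=
    memLp_of_continuousOn ((contDiff_cexp_I_mul K).continuous_deriv le_rfl).continuousOn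
  obtain ⟨h, -, hv⟩ := exists_param (K := K) hac hd (by simp)
  refine ⟨h, fun h0 => ?_⟩
  have h1 : ‖valOp K h‖ ^ 2 = 1 := by
    rw [norm_sq_cellL2]
    have : ∀ᵐ y ∂cellMeasure, ‖valOp K h y‖ ^ 2 = 1 := by
      filter_upwards [hv] with y hy
      rw [hy, norm_cexp_I_mul, one_pow]
    rw [integral_congr_ae this]
    simp
  rw [h0] at h1
  simp at h1

/-- The form of kinetic and potential energy. -/
def formA (hμ₁ : IsCoefficient μ₁) (hμ₂ : IsCoefficient μ₂) (K k : ℝ) : CellL2 →L[ℂ] CellL2 :=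
  (gradOp K).adjoint ∘L mulOp μ₁ hμ₁.memLp_top ∘L gradOp K +
    ((k ^ 2 : ℝ) : ℂ) • ((valOp K).adjoint ∘L mulOp μ₂ hμ₂.memLp_top ∘L valOp K)

/-- The form of the mass. -/
def formB (hρ : IsCoefficient ρ) (K : ℝ) : CellL2 →L[ℂ] CellL2 :=
  (valOp K).adjoint ∘L mulOp ρ hρ.memLp_top ∘L valOp K

theorem isPositive_formB (hρ : IsCoefficient ρ) (K : ℝ) : (formB hρ K).IsPositive :=
  (isPositive_mulOp hρ.memLp_top (Eventually.of_forall fun y => (hρ.pos y).le)).adjoint_conj _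

theorem isPositive_formA (hμ₁ : IsCoefficient μ₁) (hμ₂ : IsCoefficient μ₂) (K k : ℝ) :
    (formA hμ₁ hμ₂ K k).IsPositive := by
  refine ((isPositive_mulOp hμ₁.memLp_top
    (Eventually.of_forall fun y => (hμ₁.pos y).le)).adjoint_conj _).add
    ((isPositive_formB hμ₂ K).smul_of_nonneg ?_)
  exact_mod_cast sq_nonneg k

theorem inner_formB (hρ : IsCoefficient ρ) (K : ℝ) (h v : CellL2) :
    ⟪formB hρ K h, v⟫_ℂ = ⟪mulOp ρ hρ.memLp_top (valOp K h), valOp K v⟫_ℂ := by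
  simp [formB, ContinuousLinearMap.adjoint_inner_left]

theorem inner_formA (hμ₁ : IsCoefficient μ₁) (hμ₂ : IsCoefficient μ₂) (K k : ℝ) (h v : CellL2) :
    ⟪formA hμ₁ hμ₂ K k h, v⟫_ℂ = ⟪mulOp μ₁ hμ₁.memLp_top (gradOp K h), gradOp K v⟫_ℂ +
      ((k ^ 2 : ℝ) : ℂ) * ⟪mulOp μ₂ hμ₂.memLp_top (valOp K h), valOp K v⟫_ℂ := by
  have : formA hμ₁ hμ₂ K k h = (gradOp K).adjoint (mulOp μ₁ hμ₁.memLp_top (gradOp K h)) +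
    ((k ^ 2 : ℝ) : ℂ) • (valOp K).adjoint (mulOp μ₂ hμ₂.memLp_top (valOp K h)) := rfl
  rw [this, inner_add_left, inner_smul_left, Complex.conj_ofReal,
    ContinuousLinearMap.adjoint_inner_left, ContinuousLinearMap.adjoint_inner_left]

theorem re_inner_formB_self (hρ : IsCoefficient ρ) (K : ℝ) (h : CellL2) :
    (⟪formB hρ K h, h⟫_ℂ).re = ∫ y, ρ y * ‖valOp K h y‖ ^ 2 ∂cellMeasure := by
  rw [inner_formB, inner_mulOp_self, Complex.ofReal_re]

theorem re_inner_formA_self (hμ₁ : IsCoefficient μ₁) (hμ₂ : IsCoefficient μ₂) (K k : ℝ)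
    (h : CellL2) :
    (⟪formA hμ₁ hμ₂ K k h, h⟫_ℂ).re = ∫ y, μ₁ y * ‖gradOp K h y‖ ^ 2 ∂cellMeasure +
      k ^ 2 * ∫ y, μ₂ y * ‖valOp K h y‖ ^ 2 ∂cellMeasure := by
  rw [inner_formA, inner_mulOp_self, inner_mulOp_self, ← Complex.ofReal_mul, ← Complex.ofReal_add,
    Complex.ofReal_re]

/-- A critical point of the Rayleigh quotient solves the eigenvalue problem. -/
theorem exists_eigenfunction (hρ : IsCoefficient ρ) (hμ₁ : IsCoefficient μ₁)
    (hμ₂ : IsCoefficient μ₂) {K k lam : ℝ} {h : CellL2} (hB : formB hρ K h ≠ 0)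
    (hA : formA hμ₁ hμ₂ K k h = (lam : ℂ) • formB hρ K h) :
    lam ∈ eigenvalues ρ μ₁ μ₂ K k := by
  set x : CellL2 := mulOp μ₁ hμ₁.memLp_top (gradOp K h) with hx
  set f : CellL2 := ((k ^ 2 : ℝ) : ℂ) • mulOp μ₂ hμ₂.memLp_top (valOp K h) -
    (lam : ℂ) • mulOp ρ hρ.memLp_top (valOp K h) with hf
  set F : ℂ := ⟪ind 1, f⟫_ℂ with hF
  -- The weak equation, with `x = μ₁ u'` and `f = (k² μ₂ - lam ρ) u`.
  have hweak : ∀ v, ⟪x, gradOp K v⟫_ℂ + ⟪f, valOp K v⟫_ℂ = 0 := by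
    intro v
    have := congrArg (fun z => ⟪z, v⟫_ℂ) hA
    simp only [inner_formA, inner_smul_left, inner_formB, Complex.conj_ofReal] at this
    rw [hf, inner_sub_left, inner_smul_left, inner_smul_left, Complex.conj_ofReal,
      Complex.conj_ofReal, hx]
    linear_combination this
  set z : CellL2 := x - prim f + F • ind 1 with hz
  have hconjF : ⟪f, ind 1⟫_ℂ = conj F := (inner_conj_symm _ _).symm
  -- After integration by parts the weak equation says that `z` minus this constant is orthogonal to
  -- every `v`; it is tested against that difference itself.
  have hz1 : z = (conj (bloch K) * ⟪ind 1, z⟫_ℂ - F) • ind 1 := by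
    rw [← sub_eq_zero, ← inner_self_eq_zero (𝕜 := ℂ)]
    set v := z - (conj (bloch K) * ⟪ind 1, z⟫_ℂ - F) • ind 1 with hv
    have h1 := hweak v
    have h2 := inner_prim_add_inner_prim f (gradOp K v)
    have h3 : ⟪z, gradOp K v⟫_ℂ + conj F * ⟪ind 1, v⟫_ℂ = 0 := by
      rw [valOp_apply, inner_add_right, inner_smul_right, hconjF] at h1
      rw [hconjF] at h2
      rw [hz, inner_add_left, inner_sub_left, inner_smul_left]
      linear_combination h1 - h2
    rw [gradOp_apply, inner_sub_right, inner_smul_right] at h3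
    nth_rw 1 [hv]
    rw [inner_sub_left, inner_smul_left, map_sub, map_mul, Complex.conj_conj, inner_conj_symm]
    linear_combination h3
  set D : ℂ := conj (bloch K) * ⟪ind 1, z⟫_ℂ - F with hD
  have hDz : ⟪ind 1, z⟫_ℂ = D := by
    rw [hz1, inner_smul_right, inner_ind_one_self, mul_one]
  have hDF : D = conj (bloch K) * D - F := by
    nth_rw 1 [hD]; rw [hDz]
  -- Regularity: the flux is a primitive of `f`, with end values `D - F` at `0` and `D` at `1`. The
  -- relation `hDF` amounts to `D - F = exp (-iK) D`, which is the natural boundary condition.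
  have hxe : x = prim f + (D - F) • ind 1 := by
    have : x = z + prim f - F • ind 1 := by rw [hz]; abel
    rw [this, hz1, sub_smul D F]; abel
  set u : ℝ → ℂ := fun y => ⟪ind 1, h⟫_ℂ + ⟪ind y, gradOp K h⟫_ℂ with hu
  set w : ℝ → ℂ := fun y => (D - F) + ⟪ind y, f⟫_ℂ with hw
  have hconst : ∀ c : ℂ, AbsolutelyContinuousOnInterval (fun _ : ℝ => c) 0 1 := fun c =>
    contDiff_const.contDiffOn.absolutelyContinuousOnInterval
  have hval : valOp K h =ᵐ[cellMeasure] u := coeFn_valOp K h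
  have hu' : ∀ᵐ y ∂cellMeasure, deriv u y = gradOp K h y := by
    filter_upwards [prim_hasDerivAt (gradOp K h)] with y hy
    exact (hy.const_add _).deriv
  have hw' : ∀ᵐ y ∂cellMeasure, deriv w y = f y := by
    filter_upwards [prim_hasDerivAt f] with y hy
    exact (hy.const_add _).deriv
  have hfy : ∀ᵐ y ∂cellMeasure, f y = ((k : ℂ) ^ 2 * μ₂ y - lam * ρ y) * u y := by
    filter_upwards [Lp.coeFn_sub (((k ^ 2 : ℝ) : ℂ) • mulOp μ₂ hμ₂.memLp_top (valOp K h))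
      ((lam : ℂ) • mulOp ρ hρ.memLp_top (valOp K h)),
      Lp.coeFn_smul ((k ^ 2 : ℝ) : ℂ) (mulOp μ₂ hμ₂.memLp_top (valOp K h)),
      Lp.coeFn_smul (lam : ℂ) (mulOp ρ hρ.memLp_top (valOp K h)),
      coeFn_mulOp hμ₂.memLp_top (valOp K h), coeFn_mulOp hρ.memLp_top (valOp K h), hval]
      with y h1 h2 h3 h4 h5 h6
    rw [hf, h1, Pi.sub_apply, h2, h3, Pi.smul_apply, Pi.smul_apply, h4, h5, h6, smul_eq_mul,
      smul_eq_mul]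
    push_cast
    ring
  refine ⟨u, w, ⟨(hconst _).add (prim_ac _), (hconst _).add (prim_ac _), ?_, ?_, ?_⟩, ?_, ?_⟩
  · rw [restrict_Icc_eq_cellMeasure]
    filter_upwards [hu', coeFn_mulOp hμ₁.memLp_top (gradOp K h), coeFn_prim f, coeFn_ind_one,
      Lp.coeFn_add (prim f) ((D - F) • ind 1), Lp.coeFn_smul (D - F) (ind 1)]
      with y h1 h2 h3 h4 h5 h6
    rw [h1, ← h2, ← hx, hxe, h5, Pi.add_apply, h3, h6, Pi.smul_apply, h4, hw, smul_eq_mul, mul_one,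
      add_comm]
  · simp only [hu, inner_ind_zero, add_zero]
    exact inner_ind_one_gradOp K h
  · have he : Complex.exp (Complex.I * K) * Complex.exp (-(Complex.I * K)) = 1 := by
      rw [← Complex.exp_add, add_neg_cancel, Complex.exp_zero]
    simp only [hw, inner_ind_zero, add_zero, ← hF, sub_add_cancel]
    rw [conj_bloch] at hDF
    linear_combination (-D) * he + Complex.exp (Complex.I * K) * hDF
  · by_contra! hcon
    refine hB ?_
    have h0 : valOp K h = 0 := by
      refine Lp.ext ?_
      filter_upwards [hval, ae_mem_Icc, Lp.coeFn_zero ℂ 2 cellMeasure] with y h1 h2 h3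
      rw [h1, h3, hcon y h2]; rfl
    simp [formB, h0]
  · rw [restrict_Icc_eq_cellMeasure]
    filter_upwards [hw', hfy] with y h1 h2
    have hρy : (ρ y : ℂ) ≠ 0 := by exact_mod_cast (hρ.pos y).ne'
    rw [operatorA, h1, h2]
    field_simp
    ring

/-- The variational principle: the least Rayleigh quotient is an eigenvalue. -/
theorem exists_ground_state (hρ : IsCoefficient ρ) (hμ₁ : IsCoefficient μ₁)
    (hμ₂ : IsCoefficient μ₂) (K k : ℝ) : ∃ lam ∈ eigenvalues ρ μ₁ μ₂ K k,
      ∀ v : ℝ → ℂ, AbsolutelyContinuousOnInterval v 0 1 → MemLp (deriv v) 2 cellMeasure →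
        v 1 = Complex.exp (Complex.I * K) * v 0 → lam * mass ρ v ≤ energy μ₁ μ₂ k v := by
  obtain ⟨c₁, hc₁, h₁⟩ := hμ₁.mul_norm_sq_le
  obtain ⟨c, hc, h₂⟩ := hρ.mul_norm_sq_le
  obtain ⟨L, hL, hLh⟩ := norm_le_gradOp_valOp K
  have hco : ∀ h, min c₁ c / L * ‖h‖ ^ 2 ≤
      (⟪formA hμ₁ hμ₂ K k h, h⟫_ℂ).re + (⟪formB hρ K h, h⟫_ℂ).re := by
    intro h
    rw [re_inner_formA_self, re_inner_formB_self]
    have h3 : 0 ≤ ∫ y, μ₂ y * ‖valOp K h y‖ ^ 2 ∂cellMeasure :=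
      integral_nonneg fun y => mul_nonneg (hμ₂.pos y).le (by positivity)
    have h4 : min c₁ c / L * ‖h‖ ^ 2 ≤ min c₁ c * (‖gradOp K h‖ ^ 2 + ‖valOp K h‖ ^ 2) := by
      rw [div_mul_eq_mul_div, div_le_iff₀ hL, mul_assoc, mul_comm _ L]
      exact mul_le_mul_of_nonneg_left (hLh h) (le_min hc₁.le hc.le)
    have h5 : min c₁ c * ‖gradOp K h‖ ^ 2 ≤ c₁ * ‖gradOp K h‖ ^ 2 := by
      gcongr; exact min_le_left _ _
    have h6 : min c₁ c * ‖valOp K h‖ ^ 2 ≤ c * ‖valOp K h‖ ^ 2 := by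
      gcongr; exact min_le_right _ _
    linarith [h₁ (gradOp K h), h₂ (valOp K h), mul_nonneg (sq_nonneg k) h3]
  have hne : ∃ h, 0 < (⟪formB hρ K h, h⟫_ℂ).re := by
    obtain ⟨h, hh⟩ := exists_valOp_ne_zero K
    refine ⟨h, ?_⟩
    rw [re_inner_formB_self]
    have : 0 < ‖valOp K h‖ := norm_pos_iff.2 hh
    exact lt_of_lt_of_le (by positivity) (h₂ (valOp K h))
  have hcomp : IsCompactOperator (formB hρ K) :=
    (isCompactOperator_valOp K).clm_comp ((valOp K).adjoint ∘L mulOp ρ hρ.memLp_top)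
  obtain ⟨lam, ⟨h, hB, hA⟩, hmin⟩ := exists_rayleigh_minimizer (isPositive_formA hμ₁ hμ₂ K k)
    (isPositive_formB hρ K) hcomp hne (by positivity) hco
  refine ⟨lam, exists_eigenfunction hρ hμ₁ hμ₂ (fun h0 => ?_) hA, fun v hv hv' hbc => ?_⟩
  · rw [h0] at hB; simp at hB
  · obtain ⟨g, hg, hg'⟩ := exists_param hv hv' hbc
    have := hmin g
    rwa [re_inner_formA_self, re_inner_formB_self, integral_mul_norm_sq_congr ρ hg',
      integral_mul_norm_sq_congr μ₂ hg', integral_mul_norm_sq_congr μ₁ hg] at this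

end GroundState

/-! ### The eigenvalue equation as a first-order system for `(u, μ₁ u')`. -/

section Eigenfunctions

variable {ρ μ₁ μ₂ : ℝ → ℝ}

/-- `u` and its flux `w = μ₁ u'` solve `(μ₁ u')' = q u` on the unit cell. -/
structure IsSolution (μ₁ q : ℝ → ℝ) (u w : ℝ → ℂ) : Prop where
  ac : AbsolutelyContinuousOnInterval u 0 1
  ac_flux : AbsolutelyContinuousOnInterval w 0 1
  hasDerivAt : ∀ᵐ y ∂cellMeasure, HasDerivAt u (w y / μ₁ y) y
  hasDerivAt_flux : ∀ᵐ y ∂cellMeasure, HasDerivAt w (q y * u y) y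

theorem InDomain.isSolution (hρ : IsCoefficient ρ) (hμ₁ : IsCoefficient μ₁) {K k lam : ℝ}
    {u w : ℝ → ℂ} (h : InDomain μ₁ K u w)
    (he : ∀ᵐ y ∂(volume.restrict (Icc (0 : ℝ) 1)), operatorA ρ μ₂ k u w y = (lam : ℂ) * u y) :
    IsSolution μ₁ (fun y => k ^ 2 * μ₂ y - lam * ρ y) u w := by
  have hf := h.flux_eq
  rw [restrict_Icc_eq_cellMeasure] at he hf
  refine ⟨h.ac, h.ac_flux, ?_, ?_⟩
  · filter_upwards [hf, ae_cellMeasure_of_ae (ae_differentiableAt_of_ac h.ac)] with y h1 h2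
    have : (μ₁ y : ℂ) ≠ 0 := by exact_mod_cast (hμ₁.pos y).ne'
    rw [h1, mul_div_cancel_left₀ _ this]
    exact h2.hasDerivAt
  · filter_upwards [he, ae_cellMeasure_of_ae (ae_differentiableAt_of_ac h.ac_flux)] with y h1 h2
    have h3 : (ρ y : ℂ) ≠ 0 := by exact_mod_cast (hρ.pos y).ne'
    have h4 : deriv w y = ((k ^ 2 * μ₂ y - lam * ρ y : ℝ) : ℂ) * u y := by
      rw [operatorA] at h1
      field_simp at h1
      push_cast
      linear_combination -h1
    rw [← h4]
    exact h2.hasDerivAt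

/-- The flux is bounded and `μ₁` is bounded below, so `u' = w / μ₁` is bounded. Hence eigenfunctions
are admissible trial functions. -/
theorem IsSolution.memLp_deriv (hμ₁ : IsCoefficient μ₁) {q : ℝ → ℝ} {u w : ℝ → ℂ}
    (h : IsSolution μ₁ q u w) : MemLp (deriv u) 2 cellMeasure := by
  obtain ⟨c, hc, hcμ⟩ := hμ₁.strictlyPositive
  obtain ⟨C, hC⟩ := h.ac_flux.exists_bound
  refine MemLp.of_bound (measurable_deriv u).aestronglyMeasurable (C / c) ?_
  filter_upwards [h.hasDerivAt, ae_mem_Icc] with y h1 h2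
  rw [h1.deriv, norm_div, Complex.norm_real, Real.norm_of_nonneg (hμ₁.pos y).le]
  rw [← uIcc_of_le zero_le_one] at h2
  have := hC y h2
  exact div_le_div₀ ((norm_nonneg _).trans this) this hc (hcμ y)

/-- Pairing the eigenvalue equation with the eigenfunction. -/
theorem energy_eq_of_eigenfunction (hρ : IsCoefficient ρ) (hμ₁ : IsCoefficient μ₁)
    (hμ₂ : IsCoefficient μ₂) {K k lam : ℝ} {u w : ℝ → ℂ} (h : InDomain μ₁ K u w)
    (hs : IsSolution μ₁ (fun y => k ^ 2 * μ₂ y - lam * ρ y) u w) :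
    lam * mass ρ u = energy μ₁ μ₂ k u := by
  have hconj := Complex.isometry_conj.lipschitz.comp_absolutelyContinuousOnInterval h.ac_flux
  -- The derivative of `conj w * u` is `μ₁ |u'|² + (k² μ₂ - lam ρ) |u|²`. Its integral vanishes
  -- because the two boundary phases cancel.
  have h1 := integral_deriv_of_ac (hconj.smul h.ac)
  have hexp : conj (Complex.exp (Complex.I * K)) * Complex.exp (Complex.I * K) = 1 := by
    rw [← Complex.exp_conj, ← Complex.exp_add]
    simp
  have hbc : conj (w 1) * u 1 - conj (w 0) * u 0 = 0 := by
    rw [h.bc, h.bc_flux, map_mul]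
    linear_combination (conj (w 0) * u 0) * hexp
  simp only [Pi.smul_apply', smul_eq_mul] at h1
  have hu2 : MemLp u 2 cellMeasure := memLp_of_ac h.ac
  have i1 := integrable_mul_norm_sq hμ₁.memLp_top (hs.memLp_deriv hμ₁)
  have i2 := integrable_mul_norm_sq hμ₂.memLp_top hu2
  have i3 := integrable_mul_norm_sq hρ.memLp_top hu2
  rw [hbc, ← integral_cellMeasure] at h1
  have h2 : ∫ y, (μ₁ y * ‖deriv u y‖ ^ 2 + (k ^ 2 * (μ₂ y * ‖u y‖ ^ 2)
      - lam * (ρ y * ‖u y‖ ^ 2))) ∂cellMeasure = 0 := by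
    rw [← Complex.ofReal_inj, ← integral_complex_ofReal, Complex.ofReal_zero, ← h1]
    refine integral_congr_ae ?_
    filter_upwards [hs.hasDerivAt, hs.hasDerivAt_flux] with y h3 h4
    have h5 := ((Complex.conjCLE.toContinuousLinearMap.hasFDerivAt.comp_hasDerivAt y h4).mul h3)
    refine Eq.trans ?_ h5.deriv.symm
    have h6 : (μ₁ y : ℂ) ≠ 0 := by exact_mod_cast (hμ₁.pos y).ne'
    have e1 : ((‖u y‖ ^ 2 : ℝ) : ℂ) = conj (u y) * u y := by
      rw [mul_comm, Complex.mul_conj, Complex.normSq_eq_norm_sq]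
    have e2 : ((‖w y / μ₁ y‖ ^ 2 : ℝ) : ℂ) = conj (w y) * w y / (μ₁ y * μ₁ y) := by
      rw [← Complex.normSq_eq_norm_sq, ← Complex.mul_conj, map_div₀, Complex.conj_ofReal]
      field_simp
    simp only [Function.comp, ContinuousLinearEquiv.coe_coe, Complex.conjCLE_apply, map_mul,
      Complex.conj_ofReal]
    rw [h3.deriv]
    simp only [Complex.ofReal_add, Complex.ofReal_sub, Complex.ofReal_mul, e1, e2]
    push_cast
    field_simp
    ring
  have i4 : Integrable (fun y => k ^ 2 * (μ₂ y * ‖u y‖ ^ 2) - lam * (ρ y * ‖u y‖ ^ 2))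
      cellMeasure := (i2.const_mul _).sub (i3.const_mul _)
  rw [integral_add i1 i4, integral_sub (i2.const_mul _) (i3.const_mul _), integral_const_mul,
    integral_const_mul] at h2
  rw [mass, energy]
  linarith

theorem mass_pos (hρ : IsCoefficient ρ) {u : ℝ → ℂ} (hu : AbsolutelyContinuousOnInterval u 0 1)
    (hne : ∃ y ∈ Icc (0 : ℝ) 1, u y ≠ 0) : 0 < mass ρ u := by
  obtain ⟨c, hc, hcρ⟩ := hρ.strictlyPositive
  obtain ⟨y, hy, hne⟩ := hne
  have hcont : ContinuousOn u (Icc 0 1) := by simpa [uIcc_of_le zero_le_one] using hu.continuousOn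
  have h1 : 0 < ∫ t in (0 : ℝ)..1, c * ‖u t‖ ^ 2 :=
    intervalIntegral.integral_pos zero_lt_one (continuousOn_const.mul (hcont.norm.pow 2))
      (fun t _ => by positivity) ⟨y, hy, by positivity⟩
  rw [← integral_cellMeasure] at h1
  refine h1.trans_le (integral_mono ?_ (integrable_mul_norm_sq hρ.memLp_top (memLp_of_ac hu))
    fun t => mul_le_mul_of_nonneg_right (hcρ t) (by positivity))
  have h2 : MemLp u 2 cellMeasure := memLp_of_ac hu
  exact ((memLp_two_iff_integrable_sq_norm h2.1).1 h2).const_mul c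

theorem integral_gronwall_zero {f : ℝ → ℝ} {C : ℝ} (hf : ContinuousOn f (Icc 0 1))
    (h0 : ∀ y ∈ Icc (0 : ℝ) 1, 0 ≤ f y)
    (h : ∀ y ∈ Icc (0 : ℝ) 1, f y ≤ C * ∫ t in (0 : ℝ)..y, f t) :
    ∀ y ∈ Icc (0 : ℝ) 1, f y = 0 := by
  have hint : IntervalIntegrable f volume 0 1 :=
    ContinuousOn.intervalIntegrable (by rwa [uIcc_of_le zero_le_one])
  have hnn : ∀ y ∈ Icc (0 : ℝ) 1, 0 ≤ ∫ t in (0 : ℝ)..y, f t := fun y hy =>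
    intervalIntegral.integral_nonneg hy.1 fun t ht => h0 t ⟨ht.1, ht.2.trans hy.2⟩
  have hE : ∀ y ∈ Icc (0 : ℝ) 1, ‖∫ t in (0 : ℝ)..y, f t‖ ≤ gronwallBound 0 |C| 0 (y - 0) := by
    refine norm_le_gronwallBound_of_norm_deriv_right_le (f' := f) ?_ ?_ (by simp) ?_
    · have := intervalIntegral.continuousOn_primitive_interval' hint left_mem_uIcc
      rwa [uIcc_of_le zero_le_one] at this
    · intro y hy
      have hy' : y ∈ Icc (0 : ℝ) 1 := Ico_subset_Icc_self hy
      have hmeas : StronglyMeasurableAtFilter f (𝓝[Ioi y] y) := by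
        refine ⟨Ioc y 1, Ioc_mem_nhdsGT hy.2, ?_⟩
        exact (hf.mono fun t ht => ⟨hy.1.trans ht.1.le, ht.2⟩).aestronglyMeasurable
          measurableSet_Ioc
      refine intervalIntegral.integral_hasDerivWithinAt_right
        (hint.mono_set (uIcc_subset_uIcc left_mem_uIcc (by rwa [uIcc_of_le zero_le_one]))) hmeas ?_
      refine (hf y hy').mono_of_mem_nhdsWithin ?_
      exact mem_of_superset (Ioc_mem_nhdsGT hy.2) fun t ht => ⟨hy.1.trans ht.1.le, ht.2⟩
    · intro y hy
      have hy' : y ∈ Icc (0 : ℝ) 1 := Ico_subset_Icc_self hy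
      rw [Real.norm_of_nonneg (h0 y hy'), Real.norm_of_nonneg (hnn y hy'), add_zero]
      exact (h y hy').trans (mul_le_mul_of_nonneg_right (le_abs_self C) (hnn y hy'))
  intro y hy
  have h1 := hE y hy
  rw [gronwallBound_ε0_δ0, norm_le_zero_iff] at h1
  have h2 := h y hy
  rw [h1, mul_zero] at h2
  exact le_antisymm h2 (h0 y hy)

theorem norm_le_integral_of_norm_deriv_le {u : ℝ → ℂ} {f : ℝ → ℝ}
    (hu : AbsolutelyContinuousOnInterval u 0 1) (hf : ContinuousOn f (Icc 0 1)) (h0 : u 0 = 0)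
    (h : ∀ᵐ y ∂cellMeasure, ‖deriv u y‖ ≤ f y) {y : ℝ} (hy : y ∈ Icc (0 : ℝ) 1) :
    ‖u y‖ ≤ ∫ t in (0 : ℝ)..y, f t := by
  have hu2 : AbsolutelyContinuousOnInterval u 0 y := hu.mono (uIcc_subset_uIcc left_mem_uIcc
    (by rwa [uIcc_of_le zero_le_one]))
  have h1 := integral_deriv_of_ac hu2
  rw [h0, sub_zero] at h1
  rw [← h1]
  refine intervalIntegral.norm_integral_le_of_norm_le hy.1 ?_
    (ContinuousOn.intervalIntegrable (hf.mono ?_))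
  · filter_upwards [ae_of_ae_cellMeasure h] with t ht ht'
    refine ht ?_
    rw [uIcc_of_le zero_le_one]
    exact ⟨ht'.1.le, ht'.2.trans hy.2⟩
  · rw [uIcc_of_le hy.1]
    exact Icc_subset_Icc_right hy.2

/-- Uniqueness for zero Cauchy data: Grönwall applied to `‖u‖ + ‖w‖`. Working with the flux keeps
the system's coefficients bounded without differentiating `μ₁`. -/
theorem IsSolution.eq_zero (hμ₁ : IsCoefficient μ₁) {q : ℝ → ℝ} {Q : ℝ}
    (hq : ∀ y ∈ Icc (0 : ℝ) 1, |q y| ≤ Q) {u w : ℝ → ℂ} (h : IsSolution μ₁ q u w) (hu0 : u 0 = 0)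
    (hw0 : w 0 = 0) : ∀ y ∈ Icc (0 : ℝ) 1, u y = 0 ∧ w y = 0 := by
  obtain ⟨c, hc, hcμ⟩ := hμ₁.strictlyPositive
  have hcu : ContinuousOn u (Icc 0 1) := by simpa [uIcc_of_le zero_le_one] using h.ac.continuousOn
  have hcw : ContinuousOn w (Icc 0 1) := by
    simpa [uIcc_of_le zero_le_one] using h.ac_flux.continuousOn
  have hcont : ContinuousOn (fun y => ‖u y‖ + ‖w y‖) (Icc 0 1) := hcu.norm.add hcw.norm
  have hu : ∀ᵐ y ∂cellMeasure, ‖deriv u y‖ ≤ c⁻¹ * (‖u y‖ + ‖w y‖) := by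
    filter_upwards [h.hasDerivAt] with y hy
    rw [hy.deriv, norm_div, Complex.norm_real, Real.norm_of_nonneg (hμ₁.pos y).le,
      div_eq_inv_mul]
    have : (μ₁ y)⁻¹ ≤ c⁻¹ := inv_anti₀ hc (hcμ y)
    exact mul_le_mul this (le_add_of_nonneg_left (norm_nonneg _)) (norm_nonneg _) (by positivity)
  have hw : ∀ᵐ y ∂cellMeasure, ‖deriv w y‖ ≤ Q * (‖u y‖ + ‖w y‖) := by
    filter_upwards [h.hasDerivAt_flux, ae_mem_Icc] with y hy hy'
    rw [hy.deriv, norm_mul, Complex.norm_real, Real.norm_eq_abs]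
    exact mul_le_mul (hq y hy') (le_add_of_nonneg_right (norm_nonneg _)) (norm_nonneg _)
      ((abs_nonneg _).trans (hq y hy'))
  have hcm : ∀ C : ℝ, ContinuousOn (fun y => C * (‖u y‖ + ‖w y‖)) (Icc 0 1) := fun C =>
    continuousOn_const.mul hcont
  have hN := integral_gronwall_zero (C := c⁻¹ + Q) hcont (fun y _ => by positivity) (by
    intro y hy
    have h1 := norm_le_integral_of_norm_deriv_le h.ac (hcm _) hu0 hu hy
    have h2 := norm_le_integral_of_norm_deriv_le h.ac_flux (hcm _) hw0 hw hy
    rw [intervalIntegral.integral_const_mul] at h1 h2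
    rw [add_mul]
    exact add_le_add h1 h2)
  intro y hy
  have := hN y hy
  constructor
  · exact norm_le_zero_iff.1 (by linarith [norm_nonneg (w y)])
  · exact norm_le_zero_iff.1 (by linarith [norm_nonneg (u y)])

theorem IsSolution.lincomb {q : ℝ → ℝ} {u w v z : ℝ → ℂ} (h : IsSolution μ₁ q u w)
    (h' : IsSolution μ₁ q v z) (a b : ℂ) :
    IsSolution μ₁ q (fun y => a * u y - b * v y) (fun y => a * w y - b * z y) where
  ac := (h.ac.const_smul a).sub (h'.ac.const_smul b)
  ac_flux := (h.ac_flux.const_smul a).sub (h'.ac_flux.const_smul b)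
  hasDerivAt := by
    filter_upwards [h.hasDerivAt, h'.hasDerivAt] with y h1 h2
    exact ((h1.const_mul a).sub (h2.const_mul b)).congr_deriv (by ring)
  hasDerivAt_flux := by
    filter_upwards [h.hasDerivAt_flux, h'.hasDerivAt_flux] with y h1 h2
    exact ((h1.const_mul a).sub (h2.const_mul b)).congr_deriv (by ring)

theorem IsSolution.wronskian_eq {q : ℝ → ℝ} {u w v z : ℝ → ℂ} (h : IsSolution μ₁ q u w)
    (h' : IsSolution μ₁ q v z) : u 1 * z 1 - v 1 * w 1 = u 0 * z 0 - v 0 * w 0 := by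
  have hac : AbsolutelyContinuousOnInterval (fun y => u y * z y - v y * w y) 0 1 :=
    (h.ac.smul h'.ac_flux).sub (h'.ac.smul h.ac_flux)
  obtain ⟨C, hC⟩ := hac.const_of_ae_hasDerivAt_zero (by
    have : ∀ᵐ y ∂cellMeasure, HasDerivAt (fun y => u y * z y - v y * w y) 0 y := by
      filter_upwards [h.hasDerivAt, h.hasDerivAt_flux, h'.hasDerivAt, h'.hasDerivAt_flux]
        with y h1 h2 h3 h4
      exact ((h1.mul h4).sub (h3.mul h2)).congr_deriv (by ring)
    exact ae_of_ae_cellMeasure this)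
  exact (hC 1 right_mem_uIcc).trans (hC 0 left_mem_uIcc).symm

/-- A nontrivial solution cannot be periodic when another one is antiperiodic. -/
theorem eigenvalues_zero_pi_disjoint (hρ : IsCoefficient ρ) (hμ₁ : IsCoefficient μ₁)
    (hμ₂ : IsCoefficient μ₂) (k : ℝ) :
    Disjoint (eigenvalues ρ μ₁ μ₂ 0 k) (eigenvalues ρ μ₁ μ₂ Real.pi k) := by
  rw [Set.disjoint_left]
  rintro lam ⟨u, w, hd, ⟨y, hy, hne⟩, he⟩ ⟨v, z, hd', ⟨y', hy', hne'⟩, he'⟩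
  have hs := hd.isSolution hρ hμ₁ he
  have hs' := hd'.isSolution hρ hμ₁ he'
  obtain ⟨C, hC⟩ := hρ.piecewiseContinuous.exists_bound
  obtain ⟨D, hD⟩ := hμ₂.piecewiseContinuous.exists_bound
  have hq : ∀ y ∈ Icc (0 : ℝ) 1, |k ^ 2 * μ₂ y - lam * ρ y| ≤ k ^ 2 * D + |lam| * C := by
    intro y hy
    refine (abs_sub _ _).trans ?_
    rw [abs_mul, abs_mul, abs_of_nonneg (sq_nonneg k)]
    exact add_le_add (mul_le_mul_of_nonneg_left (hD y hy) (sq_nonneg k))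
      (mul_le_mul_of_nonneg_left (hC y hy) (abs_nonneg _))
  have hu1 : u 1 = u 0 := by simpa using hd.bc
  have hw1 : w 1 = w 0 := by simpa using hd.bc_flux
  have hexp : Complex.exp (Complex.I * Real.pi) = -1 := by rw [mul_comm, Complex.exp_pi_mul_I]
  have hv1 : v 1 = -v 0 := by simpa [hexp] using hd'.bc
  have hz1 : z 1 = -z 0 := by simpa [hexp] using hd'.bc_flux
  have hW := hs.wronskian_eq hs'
  rw [hu1, hw1, hv1, hz1] at hW
  -- The boundary conditions flip the sign of the Wronskian over the period, while it is constant;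
  -- so it is zero.
  have hW0 : u 0 * z 0 = v 0 * w 0 := by linear_combination (-1 / 2) * hW
  -- Both combinations have zero Cauchy data at `0`, hence vanish at `1`, where antiperiodicity
  -- turns the differences into sums. All four products of Cauchy data are then zero, so one
  -- solution is trivial.
  have h1 := (hs.lincomb hs' (v 0) (u 0)).eq_zero hμ₁ hq (by ring) (by linear_combination -hW0)
    1 (right_mem_Icc.2 zero_le_one)
  have h2 := (hs.lincomb hs' (z 0) (w 0)).eq_zero hμ₁ hq (by linear_combination hW0) (by ring)
    1 (right_mem_Icc.2 zero_le_one)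
  simp only [hu1, hw1, hv1, hz1] at h1 h2
  have e1 : v 0 * u 0 = 0 := by linear_combination (1 / 2) * h1.1
  have e2 : z 0 * w 0 = 0 := by linear_combination (1 / 2) * h2.2
  have e3 : v 0 * w 0 = 0 := by linear_combination (1 / 2) * h1.2 - (1 / 2) * hW0
  have e4 : z 0 * u 0 = 0 := by linear_combination hW0 + e3
  by_cases h0 : v 0 = 0 ∧ z 0 = 0
  · exact hne' (hs'.eq_zero hμ₁ hq h0.1 h0.2 y' hy').1
  · refine hne (hs.eq_zero hμ₁ hq ?_ ?_ y hy).1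
    · by_contra hu
      exact h0 ⟨(mul_eq_zero.1 e1).resolve_right hu, (mul_eq_zero.1 e4).resolve_right hu⟩
    · by_contra hw
      exact h0 ⟨(mul_eq_zero.1 e3).resolve_right hw, (mul_eq_zero.1 e2).resolve_right hw⟩

end Eigenfunctions

/-! ### Bounds and strict monotonicity of the first eigenvalue. -/

section FirstEigenvalue

variable {ρ μ₁ μ₂ : ℝ → ℝ}

/-- Every eigenfunction is a trial function whose Rayleigh quotient is its own eigenvalue, so none
lies below the minimum. -/
theorem firstEigenvalue_spec (hρ : IsCoefficient ρ) (hμ₁ : IsCoefficient μ₁)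
    (hμ₂ : IsCoefficient μ₂) (K k : ℝ) :
    IsLeast (eigenvalues ρ μ₁ μ₂ K k) (firstEigenvalue ρ μ₁ μ₂ K k) ∧
      ∀ v : ℝ → ℂ, AbsolutelyContinuousOnInterval v 0 1 → MemLp (deriv v) 2 cellMeasure →
        v 1 = Complex.exp (Complex.I * K) * v 0 →
          firstEigenvalue ρ μ₁ μ₂ K k * mass ρ v ≤ energy μ₁ μ₂ k v := by
  obtain ⟨lam, hlam, hmin⟩ := exists_ground_state hρ hμ₁ hμ₂ K k
  have hleast : IsLeast (eigenvalues ρ μ₁ μ₂ K k) lam := by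
    refine ⟨hlam, ?_⟩
    rintro lam' ⟨u, w, hd, hne, he⟩
    have hs := hd.isSolution hρ hμ₁ he
    have h1 := hmin u hd.ac (hs.memLp_deriv hμ₁) hd.bc
    rw [← energy_eq_of_eigenfunction hρ hμ₁ hμ₂ hd hs] at h1
    exact le_of_mul_le_mul_right h1 (mass_pos hρ hd.ac hne)
  have heq : firstEigenvalue ρ μ₁ μ₂ K k = lam := hleast.csInf_eq
  rw [heq]
  exact ⟨hleast, hmin⟩

theorem bddBelow_range_div (hρ : IsCoefficient ρ) (hμ₂ : IsCoefficient μ₂) :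
    BddBelow (range fun y : Icc (0 : ℝ) 1 => μ₂ y / ρ y) :=
  ⟨0, by rintro _ ⟨y, rfl⟩; exact (div_pos (hμ₂.pos y) (hρ.pos y)).le⟩

theorem firstEigenvalue_ge (hρ : IsCoefficient ρ) (hμ₁ : IsCoefficient μ₁)
    (hμ₂ : IsCoefficient μ₂) (K k : ℝ) :
    k ^ 2 * (⨅ y : Icc (0 : ℝ) 1, μ₂ y / ρ y) ≤ firstEigenvalue ρ μ₁ μ₂ K k := by
  obtain ⟨u, w, hd, hne, he⟩ := (firstEigenvalue_spec hρ hμ₁ hμ₂ K k).1.1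
  have hs := hd.isSolution hρ hμ₁ he
  refine le_of_mul_le_mul_right ?_ (mass_pos hρ hd.ac hne)
  rw [energy_eq_of_eigenfunction hρ hμ₁ hμ₂ hd hs, energy, mul_assoc]
  have hu2 : MemLp u 2 cellMeasure := memLp_of_ac hd.ac
  have h1 : (⨅ y : Icc (0 : ℝ) 1, μ₂ y / ρ y) * mass ρ u ≤
      ∫ y, μ₂ y * ‖u y‖ ^ 2 ∂cellMeasure := by
    rw [mass, ← integral_const_mul]
    refine integral_mono_ae ((integrable_mul_norm_sq hρ.memLp_top hu2).const_mul _)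
      (integrable_mul_norm_sq hμ₂.memLp_top hu2) ?_
    filter_upwards [ae_mem_Icc] with y hy
    have h2 := ciInf_le (bddBelow_range_div hρ hμ₂) (⟨y, hy⟩ : Icc (0 : ℝ) 1)
    rw [le_div_iff₀ (hρ.pos y)] at h2
    rw [← mul_assoc]
    exact mul_le_mul_of_nonneg_right h2 (by positivity)
  have h2 : 0 ≤ ∫ y, μ₁ y * ‖deriv u y‖ ^ 2 ∂cellMeasure :=
    integral_nonneg fun y => mul_nonneg (hμ₁.pos y).le (by positivity)
  linarith [mul_le_mul_of_nonneg_left h1 (sq_nonneg k)]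

theorem firstEigenvalue_nonneg (hρ : IsCoefficient ρ) (hμ₁ : IsCoefficient μ₁)
    (hμ₂ : IsCoefficient μ₂) (K k : ℝ) : 0 ≤ firstEigenvalue ρ μ₁ μ₂ K k :=
  (mul_nonneg (sq_nonneg k)
    (Real.iInf_nonneg fun y : Icc (0 : ℝ) 1 => (div_pos (hμ₂.pos y) (hρ.pos y)).le)).trans
    (firstEigenvalue_ge hρ hμ₁ hμ₂ K k)

/-- The trial function `exp (iKy)` has modulus `1` and derivative of modulus `|K|`, so its energy
and mass are combinations of means. -/
theorem firstEigenvalue_le (hρ : IsCoefficient ρ) (hμ₁ : IsCoefficient μ₁)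
    (hμ₂ : IsCoefficient μ₂) (K k : ℝ) :
    firstEigenvalue ρ μ₁ μ₂ K k ≤ mean μ₁ / mean ρ * K ^ 2 + mean μ₂ / mean ρ * k ^ 2 := by
  have h1 := (firstEigenvalue_spec hρ hμ₁ hμ₂ K k).2 (fun y : ℝ => Complex.exp (Complex.I * K * y))
    (contDiff_cexp_I_mul K).contDiffOn.absolutelyContinuousOnInterval
    (memLp_of_continuousOn ((contDiff_cexp_I_mul K).continuous_deriv le_rfl).continuousOn) (by simp)
  have hd : ∀ y : ℝ, ‖deriv (fun y : ℝ => Complex.exp (Complex.I * K * y)) y‖ ^ 2 = K ^ 2 := by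
    intro y
    rw [(hasDerivAt_cexp_I_mul K y).deriv, norm_mul, norm_cexp_I_mul]
    simp
  simp only [mass, energy, norm_cexp_I_mul, hd, one_pow, mul_one, integral_mul_const,
    integral_cellMeasure] at h1
  change _ * mean ρ ≤ mean μ₁ * K ^ 2 + k ^ 2 * mean μ₂ at h1
  have h2 := (le_div_iff₀ hρ.mean_pos).2 h1
  refine h2.trans_eq ?_
  ring

/-- Applied to `f = |u|` and `g = u`, where the hypothesis is the reverse triangle inequality. -/
theorem norm_deriv_le_of_dist_le {f g : ℝ → ℂ} {f' g' : ℂ} {x : ℝ} (hf : HasDerivAt f f' x)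
    (hg : HasDerivAt g g' x) (h : ∀ y, ‖f y - f x‖ ≤ ‖g y - g x‖) : ‖f'‖ ≤ ‖g'‖ := by
  refine le_of_tendsto_of_tendsto' (hasDerivAt_iff_tendsto_slope.1 hf).norm
    (hasDerivAt_iff_tendsto_slope.1 hg).norm fun y => ?_
  rw [slope_def_module, slope_def_module, norm_smul, norm_smul]
  exact mul_le_mul_of_nonneg_left (h y) (norm_nonneg _)

/-- The diamagnetic inequality: the first eigenvalue is least for periodic conditions. -/
theorem firstEigenvalue_zero_le (hρ : IsCoefficient ρ) (hμ₁ : IsCoefficient μ₁)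
    (hμ₂ : IsCoefficient μ₂) (K k : ℝ) :
    firstEigenvalue ρ μ₁ μ₂ 0 k ≤ firstEigenvalue ρ μ₁ μ₂ K k := by
  obtain ⟨u, w, hd, hne, he⟩ := (firstEigenvalue_spec hρ hμ₁ hμ₂ K k).1.1
  have hs := hd.isSolution hρ hμ₁ he
  have hu' := hs.memLp_deriv hμ₁
  have hac : AbsolutelyContinuousOnInterval (fun y => (‖u y‖ : ℂ)) 0 1 :=
    Complex.isometry_ofReal.lipschitz.comp_absolutelyContinuousOnInterval
      (lipschitzWith_one_norm.comp_absolutelyContinuousOnInterval hd.ac)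
  have hle : ∀ᵐ y ∂cellMeasure, ‖deriv (fun y => (‖u y‖ : ℂ)) y‖ ≤ ‖deriv u y‖ := by
    filter_upwards [ae_cellMeasure_of_ae (ae_differentiableAt_of_ac hd.ac),
      ae_cellMeasure_of_ae (ae_differentiableAt_of_ac hac)] with y h1 h2
    refine norm_deriv_le_of_dist_le h2.hasDerivAt h1.hasDerivAt fun t => ?_
    rw [← Complex.ofReal_sub, Complex.norm_real, Real.norm_eq_abs]
    exact abs_norm_sub_norm_le _ _
  have hv' : MemLp (deriv fun y => (‖u y‖ : ℂ)) 2 cellMeasure :=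
    hu'.of_le (measurable_deriv _).aestronglyMeasurable hle
  have h1 := (firstEigenvalue_spec hρ hμ₁ hμ₂ 0 k).2 _ hac hv' (by
    have : ‖u 1‖ = ‖u 0‖ := by
      rw [hd.bc, norm_mul, mul_comm Complex.I, Complex.norm_exp_ofReal_mul_I, one_mul]
    simp [this])
  have h2 : mass ρ (fun y => (‖u y‖ : ℂ)) = mass ρ u := by simp [mass]
  have h3 : energy μ₁ μ₂ k (fun y => (‖u y‖ : ℂ)) ≤ energy μ₁ μ₂ k u := by
    simp only [energy, Complex.norm_real, norm_norm]
    refine add_le_add_left (integral_mono_ae (integrable_mul_norm_sq hμ₁.memLp_top hv')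
      (integrable_mul_norm_sq hμ₁.memLp_top hu') ?_) _
    filter_upwards [hle] with y hy
    exact mul_le_mul_of_nonneg_left (by gcongr) (hμ₁.pos y).le
  refine le_of_mul_le_mul_right ?_ (mass_pos hρ hd.ac hne)
  rw [energy_eq_of_eigenfunction hρ hμ₁ hμ₂ hd hs, ← h2]
  exact h1.trans h3

theorem firstEigenvalue_zero_lt_pi (hρ : IsCoefficient ρ) (hμ₁ : IsCoefficient μ₁)
    (hμ₂ : IsCoefficient μ₂) (k : ℝ) :
    firstEigenvalue ρ μ₁ μ₂ 0 k < firstEigenvalue ρ μ₁ μ₂ Real.pi k := by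
  refine (firstEigenvalue_zero_le hρ hμ₁ hμ₂ Real.pi k).lt_of_ne fun h => ?_
  refine Set.disjoint_left.1 (eigenvalues_zero_pi_disjoint hρ hμ₁ hμ₂ k)
    (firstEigenvalue_spec hρ hμ₁ hμ₂ 0 k).1.1 ?_
  rw [h]
  exact (firstEigenvalue_spec hρ hμ₁ hμ₂ Real.pi k).1.1

theorem iInf_sqrt_sq_le (hρ : IsCoefficient ρ) (hμ₂ : IsCoefficient μ₂) :
    (⨅ y : Icc (0 : ℝ) 1, √(μ₂ y / ρ y)) ^ 2 ≤ ⨅ y : Icc (0 : ℝ) 1, μ₂ y / ρ y := by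
  have : Nonempty (Icc (0 : ℝ) 1) := ⟨⟨0, left_mem_Icc.2 zero_le_one⟩⟩
  refine le_ciInf fun y => ?_
  have h1 : (⨅ y : Icc (0 : ℝ) 1, √(μ₂ y / ρ y)) ≤ √(μ₂ y / ρ y) :=
    ciInf_le ⟨0, by rintro _ ⟨z, rfl⟩; exact Real.sqrt_nonneg _⟩ y
  calc _ ≤ √(μ₂ y / ρ y) ^ 2 := by
        gcongr
        exact Real.iInf_nonneg fun z => Real.sqrt_nonneg _
    _ = μ₂ y / ρ y := Real.sq_sqrt (div_pos (hμ₂.pos y) (hρ.pos y)).le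

end FirstEigenvalue

end LayeredWave

end

theorem mainTheorem12 (ρ μ₁ μ₂ : ℝ → ℝ) (hρ : LayeredWave.IsCoefficient ρ)
    (hμ₁ : LayeredWave.IsCoefficient μ₁) (hμ₂ : LayeredWave.IsCoefficient μ₂) :
    (∀ K ∈ Set.Icc (-Real.pi) Real.pi, ∀ k : ℝ,
      IsLeast (LayeredWave.eigenvalues ρ μ₁ μ₂ K k)
        (LayeredWave.firstEigenvalue ρ μ₁ μ₂ K k) ∧
      k ^ 2 * (⨅ y : Set.Icc (0 : ℝ) 1, μ₂ y / ρ y) ≤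
        LayeredWave.firstEigenvalue ρ μ₁ μ₂ K k ∧
      LayeredWave.firstEigenvalue ρ μ₁ μ₂ K k ≤
        LayeredWave.mean μ₁ / LayeredWave.mean ρ * K ^ 2 +
          LayeredWave.mean μ₂ / LayeredWave.mean ρ * k ^ 2) ∧
    (∀ k : ℝ,
      |k| * (⨅ y : Set.Icc (0 : ℝ) 1, √(μ₂ y / ρ y)) ≤
        LayeredWave.omegaOne ρ μ₁ μ₂ 0 k ∧
      LayeredWave.omegaOne ρ μ₁ μ₂ 0 k ≤
        |k| * √(LayeredWave.mean μ₂ / LayeredWave.mean ρ) ∧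
      LayeredWave.omegaOne ρ μ₁ μ₂ 0 k < LayeredWave.omegaOne ρ μ₁ μ₂ Real.pi k ∧
      LayeredWave.omegaOne ρ μ₁ μ₂ Real.pi k ≤
        √(LayeredWave.mean μ₁ / LayeredWave.mean ρ * Real.pi ^ 2 +
          LayeredWave.mean μ₂ / LayeredWave.mean ρ * k ^ 2)) := by
  refine ⟨fun K _ k => ⟨(LayeredWave.firstEigenvalue_spec hρ hμ₁ hμ₂ K k).1,
    LayeredWave.firstEigenvalue_ge hρ hμ₁ hμ₂ K k, LayeredWave.firstEigenvalue_le hρ hμ₁ hμ₂ K k⟩,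
    fun k => ⟨?_, ?_, ?_, ?_⟩⟩
  · refine Real.le_sqrt_of_sq_le ?_
    rw [mul_pow, sq_abs]
    exact (mul_le_mul_of_nonneg_left (LayeredWave.iInf_sqrt_sq_le hρ hμ₂) (sq_nonneg k)).trans
      (LayeredWave.firstEigenvalue_ge hρ hμ₁ hμ₂ 0 k)
  · rw [← Real.sqrt_sq_eq_abs, ← Real.sqrt_mul (sq_nonneg k)]
    refine Real.sqrt_le_sqrt ((LayeredWave.firstEigenvalue_le hρ hμ₁ hμ₂ 0 k).trans_eq ?_)
    ring
  · exact Real.sqrt_lt_sqrt (LayeredWave.firstEigenvalue_nonneg hρ hμ₁ hμ₂ 0 k)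
      (LayeredWave.firstEigenvalue_zero_lt_pi hρ hμ₁ hμ₂ k)
  · exact Real.sqrt_le_sqrt (LayeredWave.firstEigenvalue_le hρ hμ₁ hμ₂ Real.pi k)
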